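/- Let $X=(X_t)_{t\ge 0}$ be a Lévy subordinator without drift, with Lévy measure $\nu$ on $(0,\infty)$: $\int_0^\infty (z\wedge 1)\,\nu(dz)<\infty$ and $\mathsf{E}e^{-uX_1}=e^{\psi_\nu(u)}$ for $\Re u\ge 0$, where $\psi_\mu(u):=\int_0^\infty(e^{-uz}-1)\,\mu(dz)$. A Lévy measure $\mu$ on $(0,\infty)$ (i.e. $\int_0^\infty (z\wedge 1)\,\mu(dz)<\infty$) is called the Lévy measure of a random variable, of a process at time $1$, or of a function $\phi$ in place of its Laplace transform, if this Laplace transform equals $e^{\psi_\mu(u)}$ for all $\Re u\ge 0$. For integer degree $n\ge 1$, the regulated $X$-clocks are Lévy subordinators $X^{(n)},Y^{(n)},Z^{(n)}$ with the one-dimensional marginals of the following processes (all equal to $0$ at $t=0$): - type I: $X^{(n)}_t\overset{d}{=}\bar X^{(n)}_t$, where $\bar X^{(0)}=X$ and $\bar X^{(n)}_t=\frac1t\int_0^t\bar X^{(n-1)}_s\,ds$; - type II: $Y^{(n)}_t\overset{d}{=}\tilde X^{(n)}_t:=\frac1t\int_0^t Y^{(n-1)}_s\,ds$, where $Y^{(0)}=X$;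 - type III: $Z^{(n)}_t\overset{d}{=}\breve X^{(n)}_t$, where $\breve X^{(n)}_t$ is $t^{-n}$ times the $n$-fold iterated integral of $X$ over $[0,t]$. For real degree $n>0$ the averages of types I and III are the fractional integrals $\bar X^{(n)}_t=\frac{1}{t\,\Gamma(n)}\int_0^t X_s\log^{n-1}(t/s)\,ds$ and $\breve X^{(n)}_t=\frac{1}{t^n\,\Gamma(n)}\int_0^t (t-s)^{n-1}X_s\,ds$; and the clocks of degree $n$ may also be specified, for all three types, by the Laplace transforms at time $1$ $$\bar\phi(u)=\exp\int_0^1\psi_\nu\Big(\Big(1-\tfrac{\Gamma(n,-\log s)}{\Gamma(n)}\Big)u\Big)ds,\quad \tilde\phi(u)=\exp\Big(\tfrac{1}{\Gamma(n)}\int_0^1(-\log v)^{n-1}\psi_\nu(uv)\,dv\Big),\quad \breve\phi(u)=\exp\int_0^1\psi_\nu\Big(\tfrac{s^nu}{\Gamma(n+1)}\Big)ds .$$ Let $n>0$ be real. With each of these specifications of degree $n$ (the recipes for integer $n$, both through the averages at time $1$ and through every clock induced by them; the fractional integrals for types I and III; the Laplace transforms for all three types), the type-I, type-II and type-III clocks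 of degree $n$ have exactly one Lévy measure each, namely, respectively, $$\bar\nu^{(n)}(dz)=\Gamma(n)\int_1^\infty\frac{\nu(d(yz))}{y^2\,Q(n,1-1/y)^{n-1}}\,dy,$$ $$\tilde\nu^{(n)}(dz)=\frac1{\Gamma(n)}\int_1^\infty\frac{(\log y)^{n-1}\,\nu(d(yz))}{y^2}\,dy,$$ $$\breve\nu^{(n)}(dz)=\int_{\Gamma(n+1)}^\infty\Big(\frac{\Gamma(n+1)}{y}\Big)^{1/n}\frac{\nu(d(yz))}{ny}\,dy .$$ Here $\nu(d(yz))$ is the measure $B\mapsto\nu(yB)$, $\Gamma(n,x)$ is the upper incomplete gamma function, and $Q(n,s)$, for $0<s\le 1$, is the unique $x\ge 0$ with $\Gamma(n,x)/\Gamma(n)=s$. If moreover $\nu(dz)=\ell(z)\,dz$ on $(0,\infty)$, then $\bar\nu^{(n)},\tilde\nu^{(n)},\breve\nu^{(n)}$ have the densities $$\bar\ell^{(n)}(z)=\Gamma(n)\int_1^\infty\frac{\ell(yz)}{y\,Q(n,1-1/y)^{n-1}}\,dy,\qquad \tilde\ell^{(n)}(z)=\frac1{\Gamma(n)}\int_1^\infty\frac{(\log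 y)^{n-1}\ell(yz)}{y}\,dy,$$ $$\breve\ell^{(n)}(z)=\int_{\Gamma(n+1)}^\infty\Big(\frac{\Gamma(n+1)}{y}\Big)^{1/n}\frac{\ell(yz)}{n}\,dy$$ with respect to Lebesgue measure on $(0,\infty)$, the integrals being finite for almost every $z>0$. -/

import Mathlib

open MeasureTheory ProbabilityTheory Set
open scoped NNReal ENNReal

universe u

noncomputable section

namespace ClockRegulation

/-! ### Lévy subordinators and their Lévy measures -/

/-- `X` is a Lévy subordinator on the probability space `(Ω, P)`: it starts at `0`, has independent
and stationary increments, and almost surely nondecreasing right-continuous paths. -/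
structure IsSubordinator {Ω : Type*} [MeasurableSpace Ω] (P : Measure Ω)
    (X : ℝ≥0 → Ω → ℝ) : Prop where
  isProbabilityMeasure : IsProbabilityMeasure P
  measurable : ∀ t, Measurable (X t)
  zero : ∀ᵐ ω ∂P, X 0 ω = 0
  indep : HasIndepIncrements X P
  stationary : ∀ s t, IdentDistrib (fun ω => X (s + t) ω - X s ω) (X t) P P
  paths : ∀ᵐ ω ∂P, Monotone (fun t => X t ω) ∧
    ∀ t, ContinuousWithinAt (fun s => X s ω) (Ici t) t

/-- The Laplace transform `u ↦ E exp (-u Y)` of a random variable. -/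
def laplaceTransform {Ω : Type*} [MeasurableSpace Ω] (P : Measure Ω) (Y : Ω → ℝ) (u : ℂ) : ℂ :=
  complexMGF Y P (-u)

/-- A Lévy measure of a subordinator: a measure carried by `(0, ∞)` with
`∫ (z ∧ 1) μ(dz) < ∞`. -/
structure IsLevyMeasure (μ : Measure ℝ) : Prop where
  nonpos_null : μ (Iic 0) = 0
  lintegral_lt_top : ∫⁻ z, ENNReal.ofReal (min z 1) ∂μ < ∞

/-- The exponent `u ↦ ∫ (exp (-u z) - 1) μ(dz)`. -/
def levyExponent (μ : Measure ℝ) (u : ℂ) : ℂ :=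
  ∫ z : ℝ, (Complex.exp (-u * z) - 1) ∂μ

/-- `μ` is a Lévy measure, and the Laplace transform `φ` is that of the triplet `(0, 0, μ)`, that is
`φ u = exp (∫ (exp (-u z) - 1) μ(dz))` for `Re u ≥ 0`. -/
def IsLevyMeasureOf (φ : ℂ → ℂ) (μ : Measure ℝ) : Prop :=
  IsLevyMeasure μ ∧ ∀ u : ℂ, 0 ≤ u.re → φ u = Complex.exp (levyExponent μ u)

/-- `W` is a Lévy subordinator induced by the process `A`: it has the same law as `A` at each
single time. -/
def IsInducedBy {Ω Ω' : Type*} [MeasurableSpace Ω] [MeasurableSpace Ω'] (P' : Measure Ω')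
    (W : ℝ≥0 → Ω' → ℝ) (P : Measure Ω) (A : ℝ≥0 → Ω → ℝ) : Prop :=
  IsSubordinator P' W ∧ ∀ t, IdentDistrib (W t) (A t) P' P

/-! ### Averaging of paths (at `t = 0` all the averages are `0`) -/

/-- The running average `t⁻¹ ∫₀ᵗ X_s ds`. -/
def runningAverage {Ω : Type*} (X : ℝ≥0 → Ω → ℝ) (t : ℝ≥0) (ω : Ω) : ℝ :=
  (t : ℝ)⁻¹ * ∫ s in (0 : ℝ)..t, X s.toNNReal ω

/-- The running average repeated `m` times. -/
def repeatedAverage {Ω : Type*} (X : ℝ≥0 → Ω → ℝ) : ℕ → ℝ≥0 → Ω → ℝ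
  | 0 => X
  | m + 1 => runningAverage (repeatedAverage X m)

/-- The running average of real degree `n > 0`:
`(t Γ(n))⁻¹ ∫₀ᵗ X_s log^{n-1} (t / s) ds`. -/
def fractionalAverage {Ω : Type*} (X : ℝ≥0 → Ω → ℝ) (n : ℝ) (t : ℝ≥0) (ω : Ω) : ℝ :=
  ((t : ℝ) * Real.Gamma n)⁻¹ *
    ∫ s in (0 : ℝ)..t, X s.toNNReal ω * Real.log (t / s) ^ (n - 1)

/-- The `m`-fold iterated integral `∫₀ᵗ ⋯ ∫ X_s ds ⋯ ds`. -/
def iteratedIntegral {Ω : Type*} (X : ℝ≥0 → Ω → ℝ) : ℕ → ℝ≥0 → Ω → ℝ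
  | 0 => X
  | m + 1 => fun t ω => ∫ s in (0 : ℝ)..t, iteratedIntegral X m s.toNNReal ω

/-- The quasi-average of integer degree: `t⁻ᵐ` times the `m`-fold iterated integral. -/
def quasiAverage {Ω : Type*} (X : ℝ≥0 → Ω → ℝ) (m : ℕ) (t : ℝ≥0) (ω : Ω) : ℝ :=
  ((t : ℝ) ^ m)⁻¹ * iteratedIntegral X m t ω

/-- The quasi-average of real degree `n > 0`, with the Riemann–Liouville fractional integral:
`t⁻ⁿ Γ(n)⁻¹ ∫₀ᵗ (t - s)^{n-1} X_s ds`. -/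
def fractionalQuasiAverage {Ω : Type*} (X : ℝ≥0 → Ω → ℝ) (n : ℝ) (t : ℝ≥0) (ω : Ω) : ℝ :=
  ((t : ℝ) ^ n * Real.Gamma n)⁻¹ *
    ∫ s in (0 : ℝ)..t, ((t : ℝ) - s) ^ (n - 1) * X s.toNNReal ω

/-- `IsTypeIIClock P X m Ω' P' W`: the process `W` on `(Ω', P')` is a type-II regulated `X`-clock of
degree `m`. The clock of degree `0` is `X`; a clock of degree `m + 1` is a Lévy subordinator induced
by the running average of a clock of degree `m`. -/
inductive IsTypeIIClock {Ω : Type u} [MeasurableSpace Ω] (P : Measure Ω) (X : ℝ≥0 → Ω → ℝ) :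
    ℕ → ∀ (Ω' : Type u) [MeasurableSpace Ω'], Measure Ω' → (ℝ≥0 → Ω' → ℝ) → Prop
  | zero : IsTypeIIClock P X 0 Ω P X
  | succ (m : ℕ) (Ω₁ Ω₂ : Type u) [MeasurableSpace Ω₁] [MeasurableSpace Ω₂]
      (P₁ : Measure Ω₁) (P₂ : Measure Ω₂) (Y : ℝ≥0 → Ω₁ → ℝ) (W : ℝ≥0 → Ω₂ → ℝ) :
      IsTypeIIClock P X m Ω₁ P₁ Y → IsInducedBy P₂ W P₁ (runningAverage Y) →
      IsTypeIIClock P X (m + 1) Ω₂ P₂ W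

/-! ### Incomplete gamma functions -/

/-- The upper incomplete gamma function `Γ(n, x)`. -/
def upperGamma (n x : ℝ) : ℝ :=
  ∫ r in Ioi x, r ^ (n - 1) * Real.exp (-r)

/-- The inverse regularized upper incomplete gamma function: `invUpperGamma n s` is the solution
`x ≥ 0` of `Γ(n, x) / Γ(n) = s` (it exists and is unique for `n > 0` and `0 < s ≤ 1`). -/
def invUpperGamma (n s : ℝ) : ℝ :=
  Function.invFunOn (fun x => upperGamma n x / Real.Gamma n) (Ici 0) s

/-! ### Laplace transforms of regulated clocks of real degree `n > 0` at time `1`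

Here `levyExponent ν` is the logarithm of the Laplace transform of the unregulated clock. -/

def typeILaplace (n : ℝ) (ν : Measure ℝ) (u : ℂ) : ℂ :=
  Complex.exp (∫ s in (0 : ℝ)..1,
    levyExponent ν (((1 - upperGamma n (-Real.log s) / Real.Gamma n : ℝ) : ℂ) * u))

def typeIILaplace (n : ℝ) (ν : Measure ℝ) (u : ℂ) : ℂ :=
  Complex.exp (((Real.Gamma n)⁻¹ : ℝ) * ∫ v in (0 : ℝ)..1,
    (((-Real.log v) ^ (n - 1) : ℝ) : ℂ) * levyExponent ν (u * v))

def typeIIILaplace (n : ℝ) (ν : Measure ℝ) (u : ℂ) : ℂ :=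
  Complex.exp (∫ s in (0 : ℝ)..1,
    levyExponent ν (((s ^ n / Real.Gamma (n + 1) : ℝ) : ℂ) * u))

/-! ### The explicit Lévy measures -/

/-- The measure `∫_{y > a} k(y) ν(d(yz)) dy`, where `ν(d(yz))` is the measure `B ↦ ν (y B)`, the
image of `ν` under `x ↦ x / y`. -/
def dilationMixture (a : ℝ) (k : ℝ → ℝ) (ν : Measure ℝ) : Measure ℝ :=
  ((volume.restrict (Ioi a)).withDensity (fun y => ENNReal.ofReal (k y))).bind
    (fun y => ν.map (fun x => x / y))

/-- `Γ(n) ∫_{y > 1} ν(d(yz)) / (y² Q(n, 1 - 1/y)^{n-1}) dy`. -/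
def typeILevyMeasure (n : ℝ) (ν : Measure ℝ) : Measure ℝ :=
  dilationMixture 1
    (fun y => Real.Gamma n * (1 / (y ^ 2 * invUpperGamma n (1 - 1 / y) ^ (n - 1)))) ν

/-- `Γ(n)⁻¹ ∫_{y > 1} (log y)^{n-1} ν(d(yz)) / y² dy`. -/
def typeIILevyMeasure (n : ℝ) (ν : Measure ℝ) : Measure ℝ :=
  dilationMixture 1 (fun y => 1 / Real.Gamma n * (Real.log y ^ (n - 1) / y ^ 2)) ν

/-- `∫_{y > Γ(n+1)} (Γ(n+1) / y)^{1/n} ν(d(yz)) / (n y) dy`. -/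
def typeIIILevyMeasure (n : ℝ) (ν : Measure ℝ) : Measure ℝ :=
  dilationMixture (Real.Gamma (n + 1))
    (fun y => (Real.Gamma (n + 1) / y) ^ (1 / n) * (1 / (n * y))) ν

/-- The measure `μ` on `(0, ∞)` has the density `g` with respect to Lebesgue measure. -/
def HasLevyDensity (μ : Measure ℝ) (g : ℝ → ℝ) : Prop :=
  μ = (volume.restrict (Ioi 0)).withDensity (fun z => ENNReal.ofReal (g z))

/-! ### The mixtures and the inverse gamma function are what they should be -/

lemma IsLevyMeasure.sigmaFinite {ν : Measure ℝ} (hν : IsLevyMeasure ν) : SigmaFinite ν := by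
  refine ⟨⟨⟨fun k => Iic 0 ∪ Ici (1 / ((k : ℝ) + 1)), fun _ => trivial, fun k => ?_, ?_⟩⟩⟩
  · refine (measure_union_le _ _).trans_lt ?_
    rw [hν.nonpos_null, zero_add]
    have hk : (0 : ℝ) < 1 / ((k : ℝ) + 1) := by positivity
    have hk1 : 1 / ((k : ℝ) + 1) ≤ 1 := by
      rw [div_le_one (by positivity)]
      linarith [(Nat.cast_nonneg k : (0 : ℝ) ≤ k)]
    have hε : ENNReal.ofReal (1 / ((k : ℝ) + 1)) ≠ 0 := by simpa using hk
    refine (measure_mono (t := {z | ENNReal.ofReal (1 / ((k : ℝ) + 1)) ≤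
      ENNReal.ofReal (min z 1)}) fun z hz => ENNReal.ofReal_le_ofReal (le_min hz hk1)).trans_lt ?_
    exact (meas_ge_le_lintegral_div (by fun_prop) hε ENNReal.ofReal_ne_top).trans_lt
      (ENNReal.div_lt_top hν.lintegral_lt_top.ne hε)
  · refine eq_univ_of_forall fun z => ?_
    rcases le_or_gt z 0 with hz | hz
    · exact mem_iUnion.2 ⟨0, Or.inl hz⟩
    · obtain ⟨k, hk⟩ := exists_nat_one_div_lt hz
      exact mem_iUnion.2 ⟨k, Or.inr hk.le⟩

lemma dilationMixture_apply {a : ℝ} (ha : 0 ≤ a) {k : ℝ → ℝ}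
    (hk : AEMeasurable k (volume.restrict (Ioi a))) {ν : Measure ℝ} [SFinite ν]
    {B : Set ℝ} (hB : MeasurableSet B) :
    dilationMixture a k ν B =
      ∫⁻ y in Ioi a, ENNReal.ofReal (k y) * ν ((fun z => y * z) '' B) := by
  have hmeas : ∀ C : Set ℝ, MeasurableSet C →
      Measurable (fun y : ℝ => ν ((fun x => x / y) ⁻¹' C)) := fun C hC =>
    measurable_measure_prodMk_left (ν := ν) (s := {p : ℝ × ℝ | p.2 / p.1 ∈ C})
      ((measurable_snd.div measurable_fst) hC)
  have hker : Measurable (fun y : ℝ => ν.map (fun x => x / y)) := by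
    refine Measure.measurable_of_measurable_coe _ fun C hC => ?_
    have : (fun y : ℝ => ν.map (fun x => x / y) C) = fun y => ν ((fun x => x / y) ⁻¹' C) := by
      funext y
      exact Measure.map_apply (measurable_id.div_const y) hC
    rw [this]
    exact hmeas C hC
  rw [dilationMixture, Measure.bind_apply hB hker.aemeasurable,
    lintegral_withDensity_eq_lintegral_mul₀ hk.ennreal_ofReal
      (g := fun y => ν.map (fun x => x / y) B)
      ((Measure.measurable_coe hB).comp hker).aemeasurable]
  refine setLIntegral_congr_fun measurableSet_Ioi fun y hy => ?_
  have hy0 : y ≠ 0 := (ha.trans_lt hy).ne'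
  simp only [Pi.mul_apply]
  rw [Measure.map_apply (by fun_prop) hB]
  congr 2
  ext x
  simp only [mem_preimage, mem_image]
  constructor
  · intro hx
    exact ⟨x / y, hx, by field_simp⟩
  · rintro ⟨z, hz, rfl⟩
    simpa [hy0] using hz

lemma invUpperGamma_spec {n s : ℝ} (hn : 0 < n) (hs : 0 < s) (hs1 : s ≤ 1) :
    0 ≤ invUpperGamma n s ∧ upperGamma n (invUpperGamma n s) / Real.Gamma n = s ∧
      ∀ x, 0 ≤ x → upperGamma n x / Real.Gamma n = s → x = invUpperGamma n s := by
  have hG : 0 < Real.Gamma n := Real.Gamma_pos_of_pos hn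
  have hint : IntegrableOn (fun r : ℝ => r ^ (n - 1) * Real.exp (-r)) (Ioi 0) := by
    simpa [mul_comm] using Real.GammaIntegral_convergent hn
  have h0 : upperGamma n 0 = Real.Gamma n := by
    rw [upperGamma, Real.Gamma_eq_integral hn]
    simp [mul_comm]
  have hsplit : ∀ x y : ℝ, 0 ≤ x → x ≤ y → upperGamma n x =
      (∫ r in Ioc x y, r ^ (n - 1) * Real.exp (-r)) + upperGamma n y := by
    intro x y hx hxy
    rw [upperGamma, upperGamma, ← setIntegral_union (by simp) measurableSet_Ioi
      (hint.mono_set fun r hr => hx.trans_lt hr.1)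
      (hint.mono_set fun r hr => (hx.trans hxy).trans_lt hr), Ioc_union_Ioi_eq_Ioi hxy]
  have hanti : StrictAntiOn (upperGamma n) (Ici 0) := by
    intro x hx y hy hxy
    rw [hsplit x y hx hxy.le]
    have : 0 < ∫ r in x..y, r ^ (n - 1) * Real.exp (-r) := by
      refine intervalIntegral.intervalIntegral_pos_of_pos_on ?_ (fun r hr => ?_) hxy
      · rw [intervalIntegrable_iff_integrableOn_Ioc_of_le hxy.le]
        exact hint.mono_set fun r hr => lt_of_le_of_lt hx hr.1
      · have : 0 < r := lt_of_le_of_lt hx hr.1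
        positivity
    rw [intervalIntegral.integral_of_le hxy.le] at this
    linarith
  have hform : ∀ x, 0 ≤ x → upperGamma n x =
      Real.Gamma n - ∫ r in (0 : ℝ)..x, r ^ (n - 1) * Real.exp (-r) := by
    intro x hx
    rw [← h0, hsplit 0 x le_rfl hx, intervalIntegral.integral_of_le hx]
    ring
  have hcont : ∀ b : ℝ, 0 ≤ b → ContinuousOn (upperGamma n) (Icc 0 b) := by
    intro b hb
    have h1 : IntegrableOn (fun r : ℝ => r ^ (n - 1) * Real.exp (-r)) (Icc 0 b) := by
      rw [integrableOn_Icc_iff_integrableOn_Ioc]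
      exact hint.mono_set fun r hr => hr.1
    have h2 := intervalIntegral.continuousOn_primitive_interval (a := 0) (b := b)
      (f := fun r : ℝ => r ^ (n - 1) * Real.exp (-r)) (μ := volume) (by rwa [uIcc_of_le hb])
    rw [uIcc_of_le hb] at h2
    exact (continuousOn_const.sub h2).congr fun x hx => hform x hx.1
  have hlim : Filter.Tendsto (upperGamma n) Filter.atTop (nhds 0) := by
    have h1 := intervalIntegral_tendsto_integral_Ioi 0 hint Filter.tendsto_id
    have h2 : (∫ r in Ioi (0 : ℝ), r ^ (n - 1) * Real.exp (-r)) = Real.Gamma n := h0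
    rw [h2] at h1
    have h3 := h1.const_sub (Real.Gamma n)
    rw [sub_self] at h3
    refine h3.congr' ?_
    filter_upwards [Filter.eventually_ge_atTop 0] with x hx
    exact (hform x hx).symm
  have hex : s ∈ (fun x => upperGamma n x / Real.Gamma n) '' Ici 0 := by
    have hpos : 0 < s * Real.Gamma n := mul_pos hs hG
    obtain ⟨b, hb, hb0⟩ :=
      ((hlim.eventually (gt_mem_nhds hpos)).and (Filter.eventually_ge_atTop 0)).exists
    obtain ⟨x, hx, hxs⟩ := intermediate_value_Icc' hb0 (hcont b hb0)
      (show s * Real.Gamma n ∈ Icc (upperGamma n b) (upperGamma n 0) from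
        ⟨hb.le, by rw [h0]; nlinarith⟩)
    exact ⟨x, hx.1, by simp only [hxs]; field_simp⟩
  have hmem : invUpperGamma n s ∈ Ici (0 : ℝ) := Function.invFunOn_mem hex
  have heq : upperGamma n (invUpperGamma n s) / Real.Gamma n = s := Function.invFunOn_eq hex
  refine ⟨hmem, heq, fun x hx hxs => hanti.injOn hx hmem ?_⟩
  rw [div_eq_iff hG.ne'] at hxs heq
  rw [hxs, heq]

end ClockRegulation

end

open ClockRegulation

noncomputable section

namespace ClockRegulation

/-! ### Analysis of the exponent of a Lévy measure -/

/-! Write Φ(u) = -log E exp(-u X₁), which for u ≥ 0 is ∫ (1 - exp(-uz)) ν(dz). The probabilistic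
core is `IsSubordinator.mgf_pathIntegral`: for an integrable weight g ≥ 0 on (0, 1) with tail G(s) =
∫_s^1 g, integration by parts gives ∫ X_s g(s) ds = ∫ G dX. Independence and stationarity of the
increments then give this variable the exponent ∫₀¹ Φ(u G(s)) ds. The proof passes to the limit in
Riemann sums of increments.

Type I has g(s) = (-log s)^{n-1} / Γ(n), whose tail is a regularized lower incomplete gamma function
(`tailIntegral_logWeight`). Type III has g(s) = (1-s)^{n-1} / Γ(n), with tail (1-s)^n / Γ(n+1)
(`tailIntegral_rpow`). For integer degree, Fubini's theorem on a triangle reduces iterated averages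
and iterated integrals to these single integrals (`logMean_succ`, `fracIntegral_succ`). For type II
each step replaces the exponent Φ by its mean u⁻¹ ∫₀ᵘ Φ, so the same logarithmic kernel appears, now
acting on Φ instead of on the paths (`isTypeIIClock_exponent`).

On the side of the measures, the substitution y = 1/h(s) turns each explicit formula into the image
of σ ⊗ ν under (s, x) ↦ h(s) x (`scaleMixture`), where h is the tail above (reflected for type III),
or h(s) = s with logarithmic weight for type II. By Fubini its exponent at u is the σ-integral of
the exponent of ν at h(s) u (`levyExponent_scaleMixture`), which matches.

Uniqueness, and the passage from positive real u to Re u ≥ 0, rest on analytic continuation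
(`eq_of_eqOn_real`, `IsLevyMeasure.eq_of_realExponent_eq`). The densities come from Tonelli's
theorem (`dilationMixture_hasLevyDensity`). -/

/-- Both exponentials have modulus at most 1, which gives the bound 2. The linear bound is the
standard one when ‖u‖ z ≤ 1 and follows from the bound 2 otherwise. -/
lemma norm_exp_sub_one_le_min {u : ℂ} (hu : 0 ≤ u.re) {z : ℝ} (hz : 0 ≤ z) :
    ‖Complex.exp (-u * z) - 1‖ ≤ 2 * (‖u‖ + 1) * min z 1 := by
  have h2 : ‖Complex.exp (-u * z) - 1‖ ≤ 2 := by
    refine (norm_sub_le _ _).trans ?_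
    rw [Complex.norm_exp, norm_one]
    have : Real.exp ((-u * z).re) ≤ 1 := by
      rw [Real.exp_le_one_iff]
      simp only [Complex.mul_re, Complex.neg_re, Complex.ofReal_re, Complex.neg_im,
        Complex.ofReal_im, mul_zero, sub_zero]
      nlinarith [mul_nonneg hu hz]
    linarith
  have h1 : ‖Complex.exp (-u * z) - 1‖ ≤ 2 * (‖u‖ * z) := by
    have hn : ‖-u * (z : ℂ)‖ = ‖u‖ * z := by
      rw [norm_mul, norm_neg, Complex.norm_real, Real.norm_of_nonneg hz]
    rcases le_or_gt (‖u‖ * z) 1 with h | h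
    · have := Complex.norm_exp_sub_one_le (x := -u * z) (by rwa [hn])
      rwa [hn] at this
    · linarith
  have hu' := norm_nonneg u
  rcases le_total z 1 with h | h
  · rw [min_eq_left h]
    nlinarith
  · rw [min_eq_right h]
    nlinarith

/-- Here and in the next two lemmas an atom at 0 is allowed, so that they also apply to the law of a
nonnegative random variable. -/
lemma integrable_exp_sub_one {μ : Measure ℝ} (h0 : ∀ᵐ z ∂μ, 0 ≤ z)
    (hint : Integrable (fun z : ℝ => min z 1) μ) {u : ℂ} (hu : 0 ≤ u.re) :
    Integrable (fun z : ℝ => Complex.exp (-u * z) - 1) μ := by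
  refine (hint.const_mul (2 * (‖u‖ + 1))).mono' ?_ ?_
  · exact (Continuous.aestronglyMeasurable (by fun_prop))
  · filter_upwards [h0] with z hz using norm_exp_sub_one_le_min hu hz

lemma continuousOn_levyExponent {μ : Measure ℝ} (h0 : ∀ᵐ z ∂μ, 0 ≤ z)
    (hint : Integrable (fun z : ℝ => min z 1) μ) :
    ContinuousOn (levyExponent μ) {u | 0 ≤ u.re} := by
  intro u hu
  refine continuousWithinAt_of_dominated (bound := fun z => 2 * (‖u‖ + 1 + 1) * min z 1)
    ?_ ?_ (hint.const_mul _) ?_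
  · exact Filter.Eventually.of_forall fun v => Continuous.aestronglyMeasurable (by fun_prop)
  · have : ∀ᶠ v in nhdsWithin u {u : ℂ | 0 ≤ u.re}, ‖v‖ < ‖u‖ + 1 :=
      nhdsWithin_le_nhds (continuous_norm.continuousAt.eventually_lt continuousAt_const (by simp))
    filter_upwards [this, self_mem_nhdsWithin] with v hv hv0
    filter_upwards [h0] with z hz
    refine (norm_exp_sub_one_le_min hv0 hz).trans ?_
    have : 0 ≤ min z 1 := le_min hz zero_le_one
    gcongr
  · filter_upwards with z
    exact Continuous.continuousWithinAt (by fun_prop)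

lemma differentiableOn_levyExponent {μ : Measure ℝ} (h0 : ∀ᵐ z ∂μ, 0 ≤ z)
    (hint : Integrable (fun z : ℝ => min z 1) μ) :
    DifferentiableOn ℂ (levyExponent μ) {u | 0 < u.re} := by
  intro u hu
  replace hu : 0 < u.re := hu
  -- On the half-plane Re v > ε the derivative z exp(-vz) is dominated by a multiple of min z 1,
  -- because x exp(-x) ≤ 1.
  set ε : ℝ := u.re / 2 with hε
  have hε0 : 0 < ε := by positivity
  refine DifferentiableAt.differentiableWithinAt (HasDerivAt.differentiableAt
    (hasDerivAt_integral_of_dominated_loc_of_deriv_le (s := {v | ε < v.re})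
      (F' := fun v z => Complex.exp (-v * z) * (-(z : ℂ)))
      (bound := fun z => (1 + 1 / ε) * min z 1) ?_ ?_ ?_ ?_ ?_ (hint.const_mul _) ?_).2)
  · exact (isOpen_lt continuous_const Complex.continuous_re).mem_nhds
      (by simp only [mem_ofPred_eq]; linarith)
  · exact Filter.Eventually.of_forall fun v => Continuous.aestronglyMeasurable (by fun_prop)
  · exact integrable_exp_sub_one h0 hint hu.le
  · exact Continuous.aestronglyMeasurable (by fun_prop)
  · filter_upwards [h0] with z hz v hv
    rw [norm_mul, norm_neg, Complex.norm_real, Real.norm_of_nonneg hz, Complex.norm_exp]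
    have hre : (-v * (z : ℂ)).re = -(v.re * z) := by simp
    rw [hre]
    have h1 : Real.exp (-(v.re * z)) ≤ Real.exp (-(ε * z)) :=
      Real.exp_le_exp.2 (neg_le_neg (mul_le_mul_of_nonneg_right (le_of_lt hv) hz))
    have hεz : 0 ≤ ε * z := by positivity
    have h2 : Real.exp (-(ε * z)) ≤ 1 := by rw [Real.exp_le_one_iff]; linarith
    have h3 : Real.exp (-(ε * z)) * (ε * z) ≤ 1 := by
      rw [Real.exp_neg, inv_mul_le_iff₀ (Real.exp_pos _)]
      linarith [Real.add_one_le_exp (ε * z)]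
    have h4 : 0 < Real.exp (-(v.re * z)) := Real.exp_pos _
    rcases le_total z 1 with h | h
    · rw [min_eq_left h]
      have : 0 < 1 / ε := by positivity
      nlinarith
    · rw [min_eq_right h]
      have h5 : Real.exp (-(ε * z)) * z ≤ 1 / ε := by
        rw [le_div_iff₀ hε0]
        linarith
      nlinarith
  · filter_upwards with z v _
    have h1 : HasDerivAt (fun v : ℂ => -v * z) (-(z : ℂ)) v := by
      simpa using (hasDerivAt_id v).neg.mul_const (z : ℂ)
    exact h1.cexp.sub_const 1

/-- The identity theorem applies on the open half-plane, with the points 1 + 1/(k+1) accumulating at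
1. Continuity then adds the imaginary axis, which is needed for characteristic functions. -/
lemma eq_of_eqOn_real {f g : ℂ → ℂ} (hf : DifferentiableOn ℂ f {u | 0 < u.re})
    (hg : DifferentiableOn ℂ g {u | 0 < u.re}) (hf' : ContinuousOn f {u | 0 ≤ u.re})
    (hg' : ContinuousOn g {u | 0 ≤ u.re}) (h : ∀ x : ℝ, 0 < x → f x = g x) {u : ℂ}
    (hu : 0 ≤ u.re) : f u = g u := by
  have hopen : IsOpen {u : ℂ | 0 < u.re} := isOpen_lt continuous_const Complex.continuous_re
  have hconn : IsPreconnected {u : ℂ | 0 < u.re} :=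
    (convex_halfSpace_re_gt 0).isPreconnected
  have hfreq : ∃ᶠ z in nhdsWithin (1 : ℂ) {1}ᶜ, f z = g z := by
    have ht : Filter.Tendsto (fun k : ℕ => ((1 + 1 / ((k : ℝ) + 1) : ℝ) : ℂ)) Filter.atTop
        (nhdsWithin (1 : ℂ) {1}ᶜ) := by
      refine tendsto_nhdsWithin_iff.2 ⟨?_, Filter.Eventually.of_forall fun k => ?_⟩
      · have := (tendsto_one_div_add_atTop_nhds_zero_nat (𝕜 := ℝ)).const_add 1
        rw [add_zero] at this
        exact_mod_cast (Complex.continuous_ofReal.tendsto 1).comp this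
      · have : (0 : ℝ) < 1 / ((k : ℝ) + 1) := by positivity
        intro h1
        have h2 : (1 + 1 / ((k : ℝ) + 1) : ℝ) = 1 := Complex.ofReal_eq_one.1 (mem_singleton_iff.1 h1)
        linarith
    refine ht.frequently (Filter.Frequently.of_forall fun k => h _ (by positivity))
  have heq := (hf.analyticOnNhd hopen).eqOn_of_preconnected_of_frequently_eq
    (hg.analyticOnNhd hopen) hconn (z₀ := 1) (by simp) hfreq
  refine heq.of_subset_closure hf' hg' (fun v (hv : 0 < v.re) => hv.le) ?_ hu
  rw [Complex.closure_setOfPred_lt_re]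

lemma IsLevyMeasure.ae_pos {μ : Measure ℝ} (hμ : IsLevyMeasure μ) : ∀ᵐ z ∂μ, 0 < z := by
  rw [ae_iff]
  convert hμ.nonpos_null using 2
  ext z
  simp

lemma IsLevyMeasure.ae_nonneg {μ : Measure ℝ} (hμ : IsLevyMeasure μ) : ∀ᵐ z ∂μ, 0 ≤ z :=
  hμ.ae_pos.mono fun _ h => h.le

lemma IsLevyMeasure.integrable_min {μ : Measure ℝ} (hμ : IsLevyMeasure μ) :
    Integrable (fun z : ℝ => min z 1) μ := by
  refine ⟨by fun_prop, ?_⟩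
  rw [hasFiniteIntegral_iff_ofReal]
  · exact hμ.lintegral_lt_top
  · filter_upwards [hμ.ae_nonneg] with z hz using le_min hz zero_le_one

lemma levyExponent_ofReal (μ : Measure ℝ) (u : ℝ) :
    levyExponent μ u = ((∫ z, (Real.exp (-u * z) - 1) ∂μ : ℝ) : ℂ) := by
  rw [levyExponent, ← integral_complex_ofReal]
  push_cast
  rfl

/-- The real exponent `u ↦ ∫ (1 - exp (-u z)) μ(dz)`. -/
def realExponent (μ : Measure ℝ) (u : ℝ) : ℝ := ∫ z, (1 - Real.exp (-u * z)) ∂μ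

lemma levyExponent_ofReal_eq_neg (μ : Measure ℝ) (u : ℝ) :
    levyExponent μ u = ((-realExponent μ u : ℝ) : ℂ) := by
  rw [levyExponent_ofReal, realExponent, ← integral_neg]
  simp

/-- A Lévy measure may be infinite, so it is first weighted by 1 - exp(-z), which makes it finite.
The characteristic function of the weighted measure is the difference of the exponent at -it and at
1 - it. The weight is positive almost everywhere, hence can be divided out. -/
lemma IsLevyMeasure.eq_of_realExponent_eq {μ₁ μ₂ : Measure ℝ} (h₁ : IsLevyMeasure μ₁)
    (h₂ : IsLevyMeasure μ₂) (h : ∀ u, 0 < u → realExponent μ₁ u = realExponent μ₂ u) :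
    μ₁ = μ₂ := by
  have hexp : ∀ u : ℂ, 0 ≤ u.re → levyExponent μ₁ u = levyExponent μ₂ u := fun u hu =>
    eq_of_eqOn_real (differentiableOn_levyExponent h₁.ae_nonneg h₁.integrable_min)
      (differentiableOn_levyExponent h₂.ae_nonneg h₂.integrable_min)
      (continuousOn_levyExponent h₁.ae_nonneg h₁.integrable_min)
      (continuousOn_levyExponent h₂.ae_nonneg h₂.integrable_min)
      (fun x hx => by rw [levyExponent_ofReal_eq_neg, levyExponent_ofReal_eq_neg, h x hx]) hu
  set w : ℝ → ℝ≥0∞ := fun z => ENNReal.ofReal (1 - Real.exp (-z)) with hw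
  have hwm : Measurable w := by fun_prop
  have hfin : ∀ μ : Measure ℝ, IsLevyMeasure μ → IsFiniteMeasure (μ.withDensity w) := by
    intro μ hμ
    refine isFiniteMeasure_withDensity (ne_of_lt (lt_of_le_of_lt (lintegral_mono_ae ?_)
      hμ.lintegral_lt_top))
    filter_upwards [hμ.ae_nonneg] with z hz
    refine ENNReal.ofReal_le_ofReal (le_min ?_ ?_)
    · linarith [Real.add_one_le_exp (-z)]
    · linarith [Real.exp_pos (-z)]
  have hchar : ∀ μ : Measure ℝ, IsLevyMeasure μ → ∀ t : ℝ, charFun (μ.withDensity w) t =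
      levyExponent μ (-(t * Complex.I)) - levyExponent μ (1 - t * Complex.I) := by
    intro μ hμ t
    rw [charFun_apply_real, levyExponent, levyExponent, ← integral_sub
      (integrable_exp_sub_one hμ.ae_nonneg hμ.integrable_min (by simp))
      (integrable_exp_sub_one hμ.ae_nonneg hμ.integrable_min (by simp)),
      integral_withDensity_eq_integral_toReal_smul hwm
        (Filter.Eventually.of_forall fun z => ENNReal.ofReal_lt_top)]
    refine integral_congr_ae ?_
    filter_upwards [hμ.ae_nonneg] with z hz
    have h1 : 0 ≤ 1 - Real.exp (-z) := by
      have : Real.exp (-z) ≤ 1 := by rw [Real.exp_le_one_iff]; linarith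
      linarith
    simp only [hw, ENNReal.toReal_ofReal h1, Complex.real_smul]
    push_cast
    have h2 : Complex.exp (-(1 - t * Complex.I) * z) =
        Complex.exp (-(z : ℂ)) * Complex.exp (t * z * Complex.I) := by
      rw [← Complex.exp_add]
      congr 1
      ring
    rw [h2]
    ring_nf
  have := hfin μ₁ h₁
  have := hfin μ₂ h₂
  have heq : μ₁.withDensity w = μ₂.withDensity w := by
    refine Measure.ext_of_charFun (funext fun t => ?_)
    rw [hchar μ₁ h₁, hchar μ₂ h₂, hexp _ (by simp), hexp _ (by simp)]
  have hback : ∀ μ : Measure ℝ, IsLevyMeasure μ →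
      (μ.withDensity w).withDensity (fun z => (w z)⁻¹) = μ := by
    intro μ hμ
    refine withDensity_inv_same hwm ?_ ?_
    · filter_upwards [hμ.ae_pos] with z hz
      simp [hw, hz]
    · exact Filter.Eventually.of_forall fun z => ENNReal.ofReal_ne_top
  rw [← hback μ₁ h₁, ← hback μ₂ h₂, heq]

/-- At positive arguments the exponents are real, so the exponential can be cancelled without
choosing a branch of the logarithm. -/
lemma IsLevyMeasureOf.unique {φ : ℂ → ℂ} {μ₁ μ₂ : Measure ℝ} (h₁ : IsLevyMeasureOf φ μ₁)
    (h₂ : IsLevyMeasureOf φ μ₂) : μ₁ = μ₂ := by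
  refine h₁.1.eq_of_realExponent_eq h₂.1 fun u hu => ?_
  have h := (h₁.2 u (by simpa using hu.le)).symm.trans (h₂.2 u (by simpa using hu.le))
  rw [levyExponent_ofReal_eq_neg, levyExponent_ofReal_eq_neg, ← Complex.ofReal_exp,
    ← Complex.ofReal_exp, Complex.ofReal_inj, Real.exp_eq_exp] at h
  linarith

lemma IsLevyMeasureOf.iff_eq {φ : ℂ → ℂ} {μ₀ : Measure ℝ} (h₀ : IsLevyMeasureOf φ μ₀)
    (μ : Measure ℝ) : IsLevyMeasureOf φ μ ↔ μ = μ₀ :=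
  ⟨fun h => h.unique h₀, fun h => h ▸ h₀⟩

/-! ### Laplace transforms of nonnegative random variables -/

lemma laplaceTransform_ofReal {Ω : Type*} [MeasurableSpace Ω] (P : Measure Ω) (A : Ω → ℝ)
    (u : ℝ) : laplaceTransform P A u = (mgf A P (-u) : ℂ) := by
  rw [laplaceTransform, ← Complex.ofReal_neg, complexMGF_ofReal]

/-- Regularity of a Laplace transform in the half-plane is thereby inherited from that of
`levyExponent`. -/
lemma laplaceTransform_eq_levyExponent_map {Ω : Type*} [MeasurableSpace Ω] {P : Measure Ω}
    [IsProbabilityMeasure P] {A : Ω → ℝ} (hA : AEMeasurable A P) (h0 : ∀ᵐ ω ∂P, 0 ≤ A ω)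
    {u : ℂ} (hu : 0 ≤ u.re) : laplaceTransform P A u = levyExponent (P.map A) u + 1 := by
  have h1 : Integrable (fun ω => Complex.exp (-u * A ω)) P := by
    refine Integrable.of_bound (C := 1) ?_ ?_
    · exact Complex.measurable_exp.comp_aemeasurable
        ((Complex.measurable_ofReal.comp_aemeasurable hA).const_mul _) |>.aestronglyMeasurable
    · filter_upwards [h0] with ω hω
      rw [Complex.norm_exp, Real.exp_le_one_iff]
      simp only [Complex.mul_re, Complex.neg_re, Complex.ofReal_re, Complex.neg_im,
        Complex.ofReal_im, mul_zero, sub_zero]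
      nlinarith [mul_nonneg hu hω]
  rw [laplaceTransform, complexMGF, levyExponent, integral_map hA
    (Continuous.aestronglyMeasurable (by fun_prop)), integral_sub h1 (integrable_const _)]
  simp

/-- The identity between a Laplace transform and the exponential of a Lévy exponent has to be
checked at real arguments only. -/
lemma isLevyMeasureOf_laplaceTransform {Ω : Type*} [MeasurableSpace Ω] {P : Measure Ω}
    [IsProbabilityMeasure P] {A : Ω → ℝ} (hA : AEMeasurable A P) (h0 : ∀ᵐ ω ∂P, 0 ≤ A ω)
    {μ : Measure ℝ} (hμ : IsLevyMeasure μ)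
    (h : ∀ u : ℝ, 0 < u → mgf A P (-u) = Real.exp (-realExponent μ u)) :
    IsLevyMeasureOf (laplaceTransform P A) μ := by
  refine ⟨hμ, fun u hu => ?_⟩
  have hm := Measure.isProbabilityMeasure_map hA
  have h0' : ∀ᵐ z ∂(P.map A), 0 ≤ z := (ae_map_iff hA measurableSet_Ici).2 h0
  have hint : Integrable (fun z : ℝ => min z 1) (P.map A) := by
    refine Integrable.of_bound (C := 1) (by fun_prop) ?_
    filter_upwards [h0'] with z hz
    rw [Real.norm_of_nonneg (le_min hz zero_le_one)]
    exact min_le_right _ _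
  rw [laplaceTransform_eq_levyExponent_map hA h0 hu]
  refine eq_of_eqOn_real (f := fun u => levyExponent (P.map A) u + 1)
    (g := fun u => Complex.exp (levyExponent μ u))
    ((differentiableOn_levyExponent h0' hint).add_const 1)
    (differentiableOn_levyExponent hμ.ae_nonneg hμ.integrable_min).cexp
    ((continuousOn_levyExponent h0' hint).add continuousOn_const)
    (continuousOn_levyExponent hμ.ae_nonneg hμ.integrable_min).cexp (fun x hx => ?_) hu
  rw [← laplaceTransform_eq_levyExponent_map hA h0 (by simpa using hx.le),
    laplaceTransform_ofReal, h x hx, levyExponent_ofReal_eq_neg, Complex.ofReal_exp]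

/-! ### Mixtures of dilations of a Lévy measure -/

/-- The mixture of the images of `ν` under `x ↦ h s * x`, where `s` has the law `σ`. -/
def scaleMixture (σ : Measure ℝ) (h : ℝ → ℝ) (ν : Measure ℝ) : Measure ℝ :=
  (σ.prod ν).map (fun p => h p.1 * p.2)

lemma measurable_map_div (ν : Measure ℝ) [SFinite ν] :
    Measurable (fun y : ℝ => ν.map (fun x => x / y)) := by
  refine Measure.measurable_of_measurable_coe _ fun C hC => ?_
  have : (fun y : ℝ => ν.map (fun x => x / y) C) = fun y => ν ((fun x => x / y) ⁻¹' C) := by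
    funext y
    exact Measure.map_apply (measurable_id.div_const y) hC
  rw [this]
  exact measurable_measure_prodMk_left (ν := ν) (s := {p : ℝ × ℝ | p.2 / p.1 ∈ C})
    ((measurable_snd.div measurable_fst) hC)

/-- Under y = 1/h(s), division by y becomes multiplication by h(s). The hypothesis `hpush` is this
substitution at the level of the mixing measures. -/
lemma dilationMixture_eq_scaleMixture {a : ℝ} {k h : ℝ → ℝ} {σ ν : Measure ℝ} [SFinite σ]
    [SFinite ν] (hh : Measurable h)
    (hpush : (volume.restrict (Ioi a)).withDensity (fun y => ENNReal.ofReal (k y)) =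
      σ.map (fun s => (h s)⁻¹)) :
    dilationMixture a k ν = scaleMixture σ h ν := by
  have hm : Measurable (fun p : ℝ × ℝ => h p.1 * p.2) := by fun_prop
  ext B hB
  rw [dilationMixture, hpush, Measure.bind_apply hB (measurable_map_div ν).aemeasurable,
    lintegral_map (f := fun y => ν.map (fun x => x / y) B) (g := fun s => (h s)⁻¹)
      ((Measure.measurable_coe hB).comp (measurable_map_div ν)) hh.inv,
    scaleMixture, Measure.map_apply hm hB, Measure.prod_apply (hm hB)]
  refine lintegral_congr fun s => ?_
  rw [Measure.map_apply (by fun_prop) hB]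
  congr 1
  ext x
  simp [div_inv_eq_mul, mul_comm]

/-- Change of variables y = f(s), in the shape required by `dilationMixture_eq_scaleMixture`; `hk`
is the Jacobian identity. -/
lemma withDensity_eq_map_of_hasDerivWithinAt {S : Set ℝ} (hS : MeasurableSet S) {f f' : ℝ → ℝ}
    (hfm : Measurable f) (hf : ∀ s ∈ S, HasDerivWithinAt f (f' s) S s) (hinj : InjOn f S)
    {a : ℝ} (himg : f '' S = Ioi a) {k w : ℝ → ℝ} (hk : ∀ s ∈ S, |f' s| * k (f s) = w s) :
    (volume.restrict (Ioi a)).withDensity (fun y => ENNReal.ofReal (k y)) =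
      ((volume.restrict S).withDensity (fun s => ENNReal.ofReal (w s))).map f := by
  ext B hB
  rw [Measure.map_apply hfm hB, withDensity_apply _ hB, withDensity_apply _ (hfm hB),
    ← lintegral_indicator hB, ← lintegral_indicator (hfm hB), ← himg,
    lintegral_image_eq_lintegral_abs_deriv_mul hS hf hinj]
  refine setLIntegral_congr_fun hS fun s hs => ?_
  by_cases h : f s ∈ B
  · rw [indicator_of_mem h, indicator_of_mem (mem_preimage.2 h),
      ← ENNReal.ofReal_mul (abs_nonneg _), hk s hs]
  · rw [indicator_of_notMem h, indicator_of_notMem (by simpa using h), mul_zero]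

section ScaleMixture

variable {σ ν : Measure ℝ} [IsFiniteMeasure σ] {h : ℝ → ℝ} {H : ℝ}

/-- The bound H on the dilation factors gives min(h(s) x, 1) ≤ max(H, 1) · min(x, 1), and σ is
finite. -/
lemma isLevyMeasure_scaleMixture (hh : Measurable h) (hpos : ∀ᵐ s ∂σ, 0 < h s)
    (hle : ∀ᵐ s ∂σ, h s ≤ H) (hν : IsLevyMeasure ν) : IsLevyMeasure (scaleMixture σ h ν) := by
  have := hν.sigmaFinite
  have hm : Measurable (fun p : ℝ × ℝ => h p.1 * p.2) := by fun_prop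
  constructor
  · rw [scaleMixture, Measure.map_apply hm measurableSet_Iic, Measure.prod_apply
      (hm measurableSet_Iic), lintegral_eq_zero_iff' (measurable_measure_prodMk_left
        (hm measurableSet_Iic)).aemeasurable]
    filter_upwards [hpos] with s hs
    refine measure_mono_null (fun x hx => ?_) hν.nonpos_null
    simp only [mem_preimage, mem_Iic] at hx ⊢
    by_contra hx0
    nlinarith [mul_pos hs (not_le.1 hx0)]
  · rw [scaleMixture, lintegral_map (by fun_prop) hm, lintegral_prod _ (by fun_prop)]
    calc ∫⁻ s, ∫⁻ x, ENNReal.ofReal (min (h s * x) 1) ∂ν ∂σ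
        ≤ ∫⁻ _, ENNReal.ofReal (max H 1) * ∫⁻ x, ENNReal.ofReal (min x 1) ∂ν ∂σ := by
          refine lintegral_mono_ae ?_
          filter_upwards [hpos, hle] with s hs hs'
          rw [← lintegral_const_mul _ (by fun_prop)]
          refine lintegral_mono_ae ?_
          filter_upwards [hν.ae_pos] with x hx
          rw [← ENNReal.ofReal_mul (by positivity)]
          refine ENNReal.ofReal_le_ofReal ?_
          have h1 : h s ≤ max H 1 := hs'.trans (le_max_left _ _)
          have h2 : 1 ≤ max H 1 := le_max_right _ _
          rcases le_total x 1 with hx1 | hx1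
          · rw [min_eq_left hx1]
            exact (min_le_left _ _).trans (by gcongr)
          · rw [min_eq_right hx1]
            exact (min_le_right _ _).trans (by linarith)
      _ < ∞ := by
          rw [lintegral_const]
          exact ENNReal.mul_lt_top (ENNReal.mul_lt_top ENNReal.ofReal_lt_top hν.lintegral_lt_top)
            (measure_lt_top _ _)

/-- Fubini's theorem. Integrability on the product is pulled back from the mixture, which is already
known to be a Lévy measure. -/
lemma levyExponent_scaleMixture (hh : Measurable h) (hpos : ∀ᵐ s ∂σ, 0 < h s)
    (hle : ∀ᵐ s ∂σ, h s ≤ H) (hν : IsLevyMeasure ν) {u : ℂ} (hu : 0 ≤ u.re) :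
    levyExponent (scaleMixture σ h ν) u = ∫ s, levyExponent ν ((h s : ℂ) * u) ∂σ := by
  have := hν.sigmaFinite
  have hm : Measurable (fun p : ℝ × ℝ => h p.1 * p.2) := by fun_prop
  have hL := isLevyMeasure_scaleMixture hh hpos hle hν
  have hint := integrable_exp_sub_one hL.ae_nonneg hL.integrable_min hu
  rw [scaleMixture, integrable_map_measure (Continuous.aestronglyMeasurable (by fun_prop))
    hm.aemeasurable] at hint
  rw [levyExponent, scaleMixture, integral_map hm.aemeasurable
    (Continuous.aestronglyMeasurable (by fun_prop))]
  refine (integral_prod _ hint).trans ?_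
  refine integral_congr_ae (Filter.Eventually.of_forall fun s => ?_)
  simp only [levyExponent]
  refine integral_congr_ae (Filter.Eventually.of_forall fun x => ?_)
  change Complex.exp (-u * ((h s * x : ℝ) : ℂ)) - 1 = _
  rw [Complex.ofReal_mul]
  congr 2
  ring

lemma realExponent_scaleMixture (hh : Measurable h) (hpos : ∀ᵐ s ∂σ, 0 < h s)
    (hle : ∀ᵐ s ∂σ, h s ≤ H) (hν : IsLevyMeasure ν) {u : ℝ} (hu : 0 ≤ u) :
    realExponent (scaleMixture σ h ν) u = ∫ s, realExponent ν (h s * u) ∂σ := by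
  have h1 := levyExponent_scaleMixture (u := u) hh hpos hle hν (by simpa using hu)
  simp_rw [← Complex.ofReal_mul, levyExponent_ofReal_eq_neg] at h1
  rw [integral_complex_ofReal, Complex.ofReal_inj, integral_neg] at h1
  linarith

end ScaleMixture

/-! ### The incomplete gamma function and the logarithmic kernel -/

lemma integrableOn_gammaKernel {n : ℝ} (hn : 0 < n) :
    IntegrableOn (fun r : ℝ => r ^ (n - 1) * Real.exp (-r)) (Ioi 0) := by
  simpa [mul_comm] using Real.GammaIntegral_convergent hn

lemma upperGamma_zero {n : ℝ} (hn : 0 < n) : upperGamma n 0 = Real.Gamma n := by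
  rw [upperGamma, Real.Gamma_eq_integral hn]
  simp [mul_comm]

lemma upperGamma_eq_sub {n x : ℝ} (hn : 0 < n) (hx : 0 ≤ x) :
    upperGamma n x = Real.Gamma n - ∫ r in (0 : ℝ)..x, r ^ (n - 1) * Real.exp (-r) := by
  have hint := integrableOn_gammaKernel hn
  rw [← upperGamma_zero hn, upperGamma, upperGamma, intervalIntegral.integral_of_le hx,
    ← Ioc_union_Ioi_eq_Ioi hx, setIntegral_union (by simp) measurableSet_Ioi
      (hint.mono_set fun r hr => hr.1) (hint.mono_set fun r hr => hx.trans_lt hr)]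
  ring

lemma hasDerivAt_upperGamma {n x : ℝ} (hn : 0 < n) (hx : 0 < x) :
    HasDerivAt (upperGamma n) (-(x ^ (n - 1) * Real.exp (-x))) x := by
  have hint := integrableOn_gammaKernel hn
  have hmeas : Measurable (fun r : ℝ => r ^ (n - 1) * Real.exp (-r)) := by fun_prop
  have h1 := intervalIntegral.integral_hasDerivAt_right
    (f := fun r : ℝ => r ^ (n - 1) * Real.exp (-r)) (a := 0) (b := x)
    ((intervalIntegrable_iff_integrableOn_Ioc_of_le hx.le).2 (hint.mono_set fun r hr => hr.1))
    (hmeas.stronglyMeasurable.stronglyMeasurableAtFilter)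
    ((Real.continuousAt_rpow_const x (n - 1) (Or.inl hx.ne')).mul
      (Real.continuous_exp.comp continuous_neg).continuousAt)
  refine (h1.const_sub (Real.Gamma n)).congr_of_eventuallyEq ?_
  filter_upwards [lt_mem_nhds hx] with y hy using upperGamma_eq_sub hn hy.le

/-- Measurability of parameter integrals is used instead of monotonicity, since neither n nor the
sign of the argument is restricted. -/
lemma measurable_upperGamma (n : ℝ) : Measurable (upperGamma n) := by
  have h : upperGamma n = fun x => ∫ r, {p : ℝ × ℝ | p.1 < p.2}.indicator
      (fun p : ℝ × ℝ => p.2 ^ (n - 1) * Real.exp (-p.2)) (x, r) := by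
    funext x
    rw [upperGamma, ← integral_indicator measurableSet_Ioi]
    rfl
  rw [h]
  refine (StronglyMeasurable.integral_prod_right' (StronglyMeasurable.indicator ?_ ?_)).measurable
  · exact Measurable.stronglyMeasurable (by fun_prop)
  · exact measurableSet_lt measurable_fst measurable_snd

/-- The substitution s = exp(-x) turns this into the integral defining Γ(n). -/
lemma integrableOn_neg_log_rpow {n : ℝ} (hn : 0 < n) :
    IntegrableOn (fun s : ℝ => (-Real.log s) ^ (n - 1)) (Ioo 0 1) ∧
      ∫ s in Ioo (0 : ℝ) 1, (-Real.log s) ^ (n - 1) = Real.Gamma n := by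
  have himg : (fun x : ℝ => Real.exp (-x)) '' Ioi 0 = Ioo 0 1 := by
    ext s
    constructor
    · rintro ⟨x, hx, rfl⟩
      exact ⟨Real.exp_pos _, by rw [Real.exp_lt_one_iff]; simpa using hx⟩
    · rintro ⟨h0, h1⟩
      exact ⟨-Real.log s, by simpa using Real.log_neg h0 h1, by simp [Real.exp_log h0]⟩
  have hd : ∀ x ∈ Ioi (0 : ℝ), HasDerivWithinAt (fun x : ℝ => Real.exp (-x))
      (-Real.exp (-x)) (Ioi 0) x := fun x _ => by
    simpa using ((hasDerivAt_neg x).exp).hasDerivWithinAt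
  have hinj : InjOn (fun x : ℝ => Real.exp (-x)) (Ioi 0) := fun x _ y _ hxy => by
    simpa using hxy
  have heq : ∀ x : ℝ, |-Real.exp (-x)| • (-Real.log (Real.exp (-x))) ^ (n - 1) =
      x ^ (n - 1) * Real.exp (-x) := fun x => by
    rw [abs_neg, abs_of_pos (Real.exp_pos _), Real.log_exp, neg_neg, smul_eq_mul, mul_comm]
  rw [← himg]
  constructor
  · rw [integrableOn_image_iff_integrableOn_abs_deriv_smul measurableSet_Ioi hd hinj]
    simp_rw [heq]
    exact integrableOn_gammaKernel hn
  · rw [integral_image_eq_integral_abs_deriv_smul measurableSet_Ioi hd hinj]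
    simp_rw [heq]
    exact upperGamma_zero hn

/-! ### The three mixing laws -/

lemma strictAntiOn_upperGamma {n : ℝ} (hn : 0 < n) : StrictAntiOn (upperGamma n) (Ioi 0) := by
  refine strictAntiOn_of_deriv_neg (convex_Ioi 0)
    (fun x hx => (hasDerivAt_upperGamma hn hx).continuousAt.continuousWithinAt) fun x hx => ?_
  rw [interior_Ioi] at hx
  have hx' : 0 < x := hx
  rw [(hasDerivAt_upperGamma hn hx).deriv, neg_lt_zero]
  positivity

lemma upperGamma_pos {n x : ℝ} (hn : 0 < n) (hx : 0 < x) : 0 < upperGamma n x := by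
  refine lt_of_le_of_lt ?_ (strictAntiOn_upperGamma hn hx
    (show (0 : ℝ) < x + 1 by linarith) (by linarith : x < x + 1))
  refine setIntegral_nonneg measurableSet_Ioi fun r hr => ?_
  have : 0 < r := by
    have : x + 1 < r := hr
    linarith
  positivity

lemma upperGamma_lt_Gamma {n x : ℝ} (hn : 0 < n) (hx : 0 < x) :
    upperGamma n x < Real.Gamma n := by
  rw [upperGamma_eq_sub hn hx.le]
  have : 0 < ∫ r in (0 : ℝ)..x, r ^ (n - 1) * Real.exp (-r) := by
    refine intervalIntegral.intervalIntegral_pos_of_pos_on ?_ (fun r hr => ?_) hx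
    · rw [intervalIntegrable_iff_integrableOn_Ioc_of_le hx.le]
      exact (integrableOn_gammaKernel hn).mono_set fun r hr => hr.1
    · have : 0 < r := hr.1
      positivity
  linarith

/-- The regularized lower incomplete gamma function at `-log s`. -/
def lowerGammaLog (n s : ℝ) : ℝ := 1 - upperGamma n (-Real.log s) / Real.Gamma n

section LowerGammaLog

variable {n s y : ℝ}

lemma measurable_lowerGammaLog (n : ℝ) : Measurable (lowerGammaLog n) :=
  (((measurable_upperGamma n).comp Real.measurable_log.neg).div_const _).const_sub 1

lemma neg_log_pos (hs : s ∈ Ioo (0 : ℝ) 1) : 0 < -Real.log s := by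
  simpa using Real.log_neg hs.1 hs.2

lemma lowerGammaLog_pos (hn : 0 < n) (hs : s ∈ Ioo (0 : ℝ) 1) : 0 < lowerGammaLog n s := by
  rw [lowerGammaLog, sub_pos, div_lt_one (Real.Gamma_pos_of_pos hn)]
  exact upperGamma_lt_Gamma hn (neg_log_pos hs)

lemma lowerGammaLog_lt_one (hn : 0 < n) (hs : s ∈ Ioo (0 : ℝ) 1) : lowerGammaLog n s < 1 := by
  rw [lowerGammaLog, sub_lt_self_iff]
  exact div_pos (upperGamma_pos hn (neg_log_pos hs)) (Real.Gamma_pos_of_pos hn)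

lemma hasDerivAt_lowerGammaLog (hn : 0 < n) (hs : s ∈ Ioo (0 : ℝ) 1) :
    HasDerivAt (lowerGammaLog n) (-((-Real.log s) ^ (n - 1) / Real.Gamma n)) s := by
  have h1 := (hasDerivAt_upperGamma hn (neg_log_pos hs)).comp s (Real.hasDerivAt_log hs.1.ne').neg
  convert! (h1.div_const (Real.Gamma n)).const_sub 1 using 1
  rw [neg_neg, Real.exp_log hs.1]
  have := hs.1.ne'
  field_simp

/-- With y = 1/h(s) and h = `lowerGammaLog n`, this identifies Q(n, 1 - 1/y) with -log s. -/
lemma invUpperGamma_one_sub_lowerGammaLog (hn : 0 < n) (hs : s ∈ Ioo (0 : ℝ) 1) :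
    invUpperGamma n (1 - lowerGammaLog n s) = -Real.log s :=
  ((invUpperGamma_spec hn (by linarith [lowerGammaLog_lt_one hn hs])
    (by linarith [lowerGammaLog_pos hn hs])).2.2 _ (neg_log_pos hs).le
      (by rw [lowerGammaLog]; ring)).symm

lemma one_sub_one_div_mem (hy : 1 < y) : 1 - 1 / y ∈ Ioo (0 : ℝ) 1 := by
  have h1 : 1 / y < 1 := by rwa [div_lt_one (by linarith)]
  have h2 : 0 < 1 / y := by positivity
  exact ⟨by linarith, by linarith⟩

lemma invUpperGamma_one_sub_one_div_pos (hn : 0 < n) (hy : 1 < y) :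
    0 < invUpperGamma n (1 - 1 / y) := by
  have hp := one_sub_one_div_mem hy
  obtain ⟨h0, h1, -⟩ := invUpperGamma_spec hn hp.1 hp.2.le
  refine lt_of_le_of_ne h0 fun h => hp.2.ne ?_
  rw [← h1, ← h, upperGamma_zero hn, div_self (Real.Gamma_pos_of_pos hn).ne']

lemma upperGamma_invUpperGamma (hn : 0 < n) (hy : 1 < y) :
    upperGamma n (invUpperGamma n (1 - 1 / y)) = (1 - 1 / y) * Real.Gamma n := by
  have hp := one_sub_one_div_mem hy
  rw [← div_eq_iff (Real.Gamma_pos_of_pos hn).ne']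
  exact (invUpperGamma_spec hn hp.1 hp.2.le).2.1

/-- Since `invUpperGamma` is a chosen inverse, its measurability is obtained from monotonicity. -/
lemma antitoneOn_invUpperGamma (hn : 0 < n) :
    AntitoneOn (fun y => invUpperGamma n (1 - 1 / y)) (Ioi 1) := by
  intro y hy z hz hyz
  by_contra! h
  have h1 := strictAntiOn_upperGamma hn (invUpperGamma_one_sub_one_div_pos hn hy)
    (invUpperGamma_one_sub_one_div_pos hn hz) h
  rw [upperGamma_invUpperGamma hn hy, upperGamma_invUpperGamma hn hz] at h1
  have h2 : 1 / z ≤ 1 / y :=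
    one_div_le_one_div_of_le (lt_trans one_pos hy) hyz
  nlinarith [Real.Gamma_pos_of_pos hn]

lemma aemeasurable_invUpperGamma (hn : 0 < n) :
    AEMeasurable (fun y => invUpperGamma n (1 - 1 / y)) (volume.restrict (Ioi 1)) :=
  aemeasurable_restrict_of_antitoneOn measurableSet_Ioi (antitoneOn_invUpperGamma hn)

end LowerGammaLog

/-- For y = 1/h(s) the Jacobian is (-log s)^{n-1} / (Γ(n) h(s)²), exactly the reciprocal of the
kernel Γ(n) / (y² Q^{n-1}). Hence the mixing law is uniform in s. -/
lemma typeILevyMeasure_eq {n : ℝ} (hn : 0 < n) (ν : Measure ℝ) [SFinite ν] :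
    typeILevyMeasure n ν =
      scaleMixture (volume.restrict (Ioo 0 1)) (lowerGammaLog n) ν := by
  refine dilationMixture_eq_scaleMixture (measurable_lowerGammaLog n) ?_
  have hG := Real.Gamma_pos_of_pos hn
  rw [withDensity_eq_map_of_hasDerivWithinAt (S := Ioo 0 1) (f := fun s => (lowerGammaLog n s)⁻¹)
    (f' := fun s => (-Real.log s) ^ (n - 1) / Real.Gamma n / lowerGammaLog n s ^ 2)
    (w := fun _ => 1) measurableSet_Ioo (measurable_lowerGammaLog n).inv ?_ ?_ ?_ ?_]
  · simp only [ENNReal.ofReal_one]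
    rw [← Pi.one_def, withDensity_one]
  · intro s hs
    convert! ((hasDerivAt_lowerGammaLog hn hs).inv
      (lowerGammaLog_pos hn hs).ne').hasDerivWithinAt using 1
    rw [neg_neg]
  · intro s hs t ht hst
    have h1 : lowerGammaLog n s = lowerGammaLog n t := inv_injective hst
    have h2 := invUpperGamma_one_sub_lowerGammaLog hn hs
    rw [h1, invUpperGamma_one_sub_lowerGammaLog hn ht, neg_inj] at h2
    exact (Real.log_injOn_pos ht.1 hs.1 h2).symm
  · ext y
    constructor
    · rintro ⟨s, hs, rfl⟩
      exact (one_lt_inv₀ (lowerGammaLog_pos hn hs)).2 (lowerGammaLog_lt_one hn hs)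
    · intro hy
      have hQ := invUpperGamma_one_sub_one_div_pos hn hy
      -- This is the solution s of h(s) = 1/y, read off from Q(n, 1 - 1/y) = -log s.
      refine ⟨Real.exp (-invUpperGamma n (1 - 1 / y)), ⟨Real.exp_pos _, ?_⟩, ?_⟩
      · rw [Real.exp_lt_one_iff]
        linarith
      · simp only [lowerGammaLog, Real.log_exp, neg_neg]
        rw [upperGamma_invUpperGamma hn hy, mul_div_cancel_right₀ _ hG.ne']
        simp
  · intro s hs
    have hL := neg_log_pos hs
    have hp := Real.rpow_pos_of_pos hL (n - 1)
    have hh := lowerGammaLog_pos hn hs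
    rw [abs_of_pos (by positivity), one_div (lowerGammaLog n s)⁻¹, inv_inv,
      invUpperGamma_one_sub_lowerGammaLog hn hs]
    field_simp

/-- The density of the mixing law of type II. -/
def logWeight (n s : ℝ) : ℝ := (Real.Gamma n)⁻¹ * (-Real.log s) ^ (n - 1)

lemma typeIILevyMeasure_eq {n : ℝ} (hn : 0 < n) (ν : Measure ℝ) [SFinite ν] :
    typeIILevyMeasure n ν = scaleMixture ((volume.restrict (Ioo 0 1)).withDensity
      (fun s => ENNReal.ofReal (logWeight n s))) (fun s => s) ν := by
  refine dilationMixture_eq_scaleMixture measurable_id ?_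
  have hG := Real.Gamma_pos_of_pos hn
  refine withDensity_eq_map_of_hasDerivWithinAt (f' := fun s => -(s ^ 2)⁻¹) measurableSet_Ioo
    measurable_inv (fun s hs => (hasDerivAt_inv hs.1.ne').hasDerivWithinAt)
    inv_injective.injOn ?_ ?_
  · ext y
    constructor
    · rintro ⟨s, hs, rfl⟩
      exact (one_lt_inv₀ hs.1).2 hs.2
    · intro hy
      have hy' : (1 : ℝ) < y := hy
      exact ⟨y⁻¹, ⟨by positivity, inv_lt_one_of_one_lt₀ hy'⟩, inv_inv y⟩
  · intro s hs
    have := hs.1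
    rw [abs_neg, abs_of_pos (by positivity), Real.log_inv, logWeight]
    field_simp

/-- Here y = Γ(n+1) s^{-n}, so s = (Γ(n+1)/y)^{1/n} and the kernel s/(ny) is the reciprocal of the
Jacobian; the range y > Γ(n+1) corresponds to s < 1. -/
lemma typeIIILevyMeasure_eq {n : ℝ} (hn : 0 < n) (ν : Measure ℝ) [SFinite ν] :
    typeIIILevyMeasure n ν = scaleMixture (volume.restrict (Ioo 0 1))
      (fun s => s ^ n / Real.Gamma (n + 1)) ν := by
  refine dilationMixture_eq_scaleMixture (by fun_prop) ?_
  have hG : 0 < Real.Gamma (n + 1) := Real.Gamma_pos_of_pos (by linarith)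
  rw [withDensity_eq_map_of_hasDerivWithinAt (S := Ioo 0 1)
    (f := fun s => (s ^ n / Real.Gamma (n + 1))⁻¹)
    (f' := fun s => -(n * s ^ (n - 1) / Real.Gamma (n + 1)) / (s ^ n / Real.Gamma (n + 1)) ^ 2)
    (w := fun _ => 1) measurableSet_Ioo (by fun_prop) ?_ ?_ ?_ ?_]
  · simp only [ENNReal.ofReal_one]
    rw [← Pi.one_def, withDensity_one]
  · intro s hs
    have h0 := Real.rpow_pos_of_pos hs.1 n
    exact (((Real.hasDerivAt_rpow_const (p := n) (Or.inl hs.1.ne')).div_const _).inv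
      (by positivity)).hasDerivWithinAt
  · intro s hs t ht hst
    have h1 : s ^ n / Real.Gamma (n + 1) = t ^ n / Real.Gamma (n + 1) := inv_injective hst
    rw [div_left_inj' hG.ne'] at h1
    exact (Real.rpow_left_inj hs.1.le ht.1.le hn.ne').1 h1
  · ext y
    constructor
    · rintro ⟨s, hs, rfl⟩
      have h0 := Real.rpow_pos_of_pos hs.1 n
      have h1 := Real.rpow_lt_one hs.1.le hs.2 hn
      simp only [mem_Ioi, inv_div]
      rw [lt_div_iff₀ h0]
      nlinarith
    · intro hy
      have hy' : Real.Gamma (n + 1) < y := hy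
      have hy0 : 0 < y := hG.trans hy'
      have hd : 0 < Real.Gamma (n + 1) / y := by positivity
      refine ⟨(Real.Gamma (n + 1) / y) ^ (1 / n), ⟨by positivity,
        Real.rpow_lt_one hd.le ((div_lt_one hy0).2 hy') (by positivity)⟩, ?_⟩
      simp only
      rw [← Real.rpow_mul hd.le, one_div, inv_mul_cancel₀ hn.ne', Real.rpow_one]
      field_simp
  · intro s hs
    have h0 := Real.rpow_pos_of_pos hs.1 n
    have hs0 := hs.1
    have h1 : Real.Gamma (n + 1) / (s ^ n / Real.Gamma (n + 1))⁻¹ = s ^ n := by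
      field_simp
    rw [h1, ← Real.rpow_mul hs.1.le, one_div, mul_inv_cancel₀ hn.ne', Real.rpow_one, neg_div,
      abs_neg, abs_of_pos (by positivity), Real.rpow_sub_one hs.1.ne']
    field_simp

/-! ### Exponents of the explicit measures, and the Laplace transforms of real degree -/

section Exponents

variable {n : ℝ} {ν : Measure ℝ}

lemma isFiniteMeasure_logWeight (hn : 0 < n) : IsFiniteMeasure ((volume.restrict
    (Ioo (0 : ℝ) 1)).withDensity (fun s => ENNReal.ofReal (logWeight n s))) :=
  isFiniteMeasure_withDensity_ofReal ((integrableOn_neg_log_rpow hn).1.const_mul _).2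

lemma logWeight_nonneg (hn : 0 < n) {s : ℝ} (hs : s ∈ Ioo (0 : ℝ) 1) : 0 ≤ logWeight n s := by
  have := Real.Gamma_pos_of_pos hn
  have := Real.rpow_pos_of_pos (neg_log_pos hs) (n - 1)
  rw [logWeight]
  positivity

lemma integral_logWeight {E : Type*} [NormedAddCommGroup E] [NormedSpace ℝ E] (hn : 0 < n)
    (f : ℝ → E) : ∫ s, f s ∂((volume.restrict (Ioo 0 1)).withDensity
      (fun s => ENNReal.ofReal (logWeight n s))) = ∫ s in Ioo 0 1, logWeight n s • f s := by
  have hm : Measurable (logWeight n) := by unfold logWeight; fun_prop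
  rw [integral_withDensity_eq_integral_toReal_smul hm.ennreal_ofReal
    (Filter.Eventually.of_forall fun z => ENNReal.ofReal_lt_top)]
  refine setIntegral_congr_fun measurableSet_Ioo fun s hs => ?_
  rw [ENNReal.toReal_ofReal (logWeight_nonneg hn hs)]

lemma isLevyMeasure_typeI (hn : 0 < n) (hν : IsLevyMeasure ν) :
    IsLevyMeasure (typeILevyMeasure n ν) := by
  have := hν.sigmaFinite
  rw [typeILevyMeasure_eq hn]
  exact isLevyMeasure_scaleMixture (H := 1) (measurable_lowerGammaLog n)
    (ae_restrict_of_forall_mem measurableSet_Ioo fun s hs => lowerGammaLog_pos hn hs)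
    (ae_restrict_of_forall_mem measurableSet_Ioo fun s hs => (lowerGammaLog_lt_one hn hs).le) hν

lemma realExponent_typeI (hn : 0 < n) (hν : IsLevyMeasure ν) {u : ℝ} (hu : 0 ≤ u) :
    realExponent (typeILevyMeasure n ν) u =
      ∫ s in Ioo 0 1, realExponent ν (lowerGammaLog n s * u) := by
  have := hν.sigmaFinite
  rw [typeILevyMeasure_eq hn]
  exact realExponent_scaleMixture (H := 1) (measurable_lowerGammaLog n)
    (ae_restrict_of_forall_mem measurableSet_Ioo fun s hs => lowerGammaLog_pos hn hs)
    (ae_restrict_of_forall_mem measurableSet_Ioo fun s hs => (lowerGammaLog_lt_one hn hs).le) hν hu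

lemma isLevyMeasureOf_typeILaplace (hn : 0 < n) (hν : IsLevyMeasure ν) :
    IsLevyMeasureOf (typeILaplace n ν) (typeILevyMeasure n ν) := by
  refine ⟨isLevyMeasure_typeI hn hν, fun u hu => ?_⟩
  have := hν.sigmaFinite
  rw [typeILevyMeasure_eq hn, levyExponent_scaleMixture (H := 1) (measurable_lowerGammaLog n)
    (ae_restrict_of_forall_mem measurableSet_Ioo fun s hs => lowerGammaLog_pos hn hs)
    (ae_restrict_of_forall_mem measurableSet_Ioo fun s hs => (lowerGammaLog_lt_one hn hs).le) hν hu,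
    typeILaplace, intervalIntegral.integral_of_le zero_le_one, integral_Ioc_eq_integral_Ioo]
  rfl

lemma ae_logWeight {p : ℝ → Prop} (hp : ∀ s ∈ Ioo (0 : ℝ) 1, p s) :
    ∀ᵐ s ∂((volume.restrict (Ioo (0 : ℝ) 1)).withDensity
      (fun s => ENNReal.ofReal (logWeight n s))), p s :=
  (withDensity_absolutelyContinuous _ _).ae_le (ae_restrict_of_forall_mem measurableSet_Ioo hp)

lemma isLevyMeasure_typeII (hn : 0 < n) (hν : IsLevyMeasure ν) :
    IsLevyMeasure (typeIILevyMeasure n ν) := by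
  have := hν.sigmaFinite
  have := isFiniteMeasure_logWeight hn
  rw [typeIILevyMeasure_eq hn]
  exact isLevyMeasure_scaleMixture (H := 1) (h := fun s => s) measurable_id (ae_logWeight fun s hs => hs.1)
    (ae_logWeight fun s hs => hs.2.le) hν

lemma realExponent_typeII (hn : 0 < n) (hν : IsLevyMeasure ν) {u : ℝ} (hu : 0 ≤ u) :
    realExponent (typeIILevyMeasure n ν) u =
      ∫ s in Ioo 0 1, logWeight n s * realExponent ν (s * u) := by
  have := hν.sigmaFinite
  have := isFiniteMeasure_logWeight hn
  rw [typeIILevyMeasure_eq hn, realExponent_scaleMixture (H := 1) (h := fun s => s) measurable_id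
    (ae_logWeight fun s hs => hs.1) (ae_logWeight fun s hs => hs.2.le) hν hu,
    integral_logWeight hn]
  rfl

lemma isLevyMeasureOf_typeIILaplace (hn : 0 < n) (hν : IsLevyMeasure ν) :
    IsLevyMeasureOf (typeIILaplace n ν) (typeIILevyMeasure n ν) := by
  refine ⟨isLevyMeasure_typeII hn hν, fun u hu => ?_⟩
  have := hν.sigmaFinite
  have := isFiniteMeasure_logWeight hn
  rw [typeIILevyMeasure_eq hn, levyExponent_scaleMixture (H := 1) (h := fun s => s) measurable_id
    (ae_logWeight fun s hs => hs.1) (ae_logWeight fun s hs => hs.2.le) hν hu,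
    integral_logWeight hn, typeIILaplace, intervalIntegral.integral_of_le zero_le_one,
    integral_Ioc_eq_integral_Ioo, ← integral_const_mul]
  congr 1
  refine integral_congr_ae (Filter.Eventually.of_forall fun s => ?_)
  simp only [logWeight, Complex.real_smul]
  push_cast
  rw [mul_comm u]
  ring

lemma rpow_div_Gamma_pos (hn : 0 < n) {s : ℝ} (hs : s ∈ Ioo (0 : ℝ) 1) :
    0 < s ^ n / Real.Gamma (n + 1) :=
  div_pos (Real.rpow_pos_of_pos hs.1 n) (Real.Gamma_pos_of_pos (by linarith))

/-- For 0 < n < 1 one has Γ(n+1) < 1, so the dilation factors of type III can exceed 1; this is why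
the bound H of the scale mixtures is left general. -/
lemma rpow_div_Gamma_le (hn : 0 < n) {s : ℝ} (hs : s ∈ Ioo (0 : ℝ) 1) :
    s ^ n / Real.Gamma (n + 1) ≤ 1 / Real.Gamma (n + 1) :=
  div_le_div_of_nonneg_right (Real.rpow_le_one hs.1.le hs.2.le hn.le)
    (Real.Gamma_pos_of_pos (by linarith)).le

lemma isLevyMeasure_typeIII (hn : 0 < n) (hν : IsLevyMeasure ν) :
    IsLevyMeasure (typeIIILevyMeasure n ν) := by
  have := hν.sigmaFinite
  rw [typeIIILevyMeasure_eq hn]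
  exact isLevyMeasure_scaleMixture (H := 1 / Real.Gamma (n + 1)) (by fun_prop)
    (ae_restrict_of_forall_mem measurableSet_Ioo fun s hs => rpow_div_Gamma_pos hn hs)
    (ae_restrict_of_forall_mem measurableSet_Ioo fun s hs => rpow_div_Gamma_le hn hs) hν

lemma realExponent_typeIII (hn : 0 < n) (hν : IsLevyMeasure ν) {u : ℝ} (hu : 0 ≤ u) :
    realExponent (typeIIILevyMeasure n ν) u =
      ∫ s in Ioo (0 : ℝ) 1, realExponent ν (s ^ n / Real.Gamma (n + 1) * u) := by
  have := hν.sigmaFinite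
  rw [typeIIILevyMeasure_eq hn]
  exact realExponent_scaleMixture (H := 1 / Real.Gamma (n + 1)) (by fun_prop)
    (ae_restrict_of_forall_mem measurableSet_Ioo fun s hs => rpow_div_Gamma_pos hn hs)
    (ae_restrict_of_forall_mem measurableSet_Ioo fun s hs => rpow_div_Gamma_le hn hs) hν hu

lemma isLevyMeasureOf_typeIIILaplace (hn : 0 < n) (hν : IsLevyMeasure ν) :
    IsLevyMeasureOf (typeIIILaplace n ν) (typeIIILevyMeasure n ν) := by
  refine ⟨isLevyMeasure_typeIII hn hν, fun u hu => ?_⟩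
  have := hν.sigmaFinite
  rw [typeIIILevyMeasure_eq hn, levyExponent_scaleMixture (H := 1 / Real.Gamma (n + 1))
    (by fun_prop)
    (ae_restrict_of_forall_mem measurableSet_Ioo fun s hs => rpow_div_Gamma_pos hn hs)
    (ae_restrict_of_forall_mem measurableSet_Ioo fun s hs => rpow_div_Gamma_le hn hs) hν hu,
    typeIIILaplace, intervalIntegral.integral_of_le zero_le_one, integral_Ioc_eq_integral_Ioo]

end Exponents

/-! ### Lévy densities of dilation mixtures -/

/-- The density of a dilation mixture of a measure with a density on `(0, ∞)`. -/
lemma dilationMixture_hasLevyDensity {a c : ℝ} (ha : 0 ≤ a) (hc : 0 < c) {k : ℝ → ℝ}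
    {g : ℝ → ℝ → ℝ} (hk : AEMeasurable k (volume.restrict (Ioi a))) (hk0 : ∀ y, a < y → 0 ≤ k y)
    {ν : Measure ℝ} (hν : IsLevyMeasure ν) (hL : IsLevyMeasure (dilationMixture a k ν))
    {ℓ : ℝ → ℝ} (hℓ : Measurable ℓ) (hℓ0 : ∀ z, 0 < z → 0 ≤ ℓ z) (hd : HasLevyDensity ν ℓ)
    (hg : ∀ z, 0 < z → ∀ y, a < y → c * g z y = k y * y * ℓ (y * z)) :
    (∀ᵐ z ∂(volume.restrict (Ioi (0 : ℝ))), IntegrableOn (g z) (Ioi a)) ∧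
      HasLevyDensity (dilationMixture a k ν) (fun z => c * ∫ y in Ioi a, g z y) := by
  have := hν.sigmaFinite
  -- The joint density in (z, y); the factor y is the Jacobian of the dilation x = yz.
  set F : ℝ → ℝ → ℝ≥0∞ := fun z y =>
    ENNReal.ofReal (k y) * ENNReal.ofReal y * ENNReal.ofReal (ℓ (y * z)) with hF
  have hFm : AEMeasurable (fun p : ℝ × ℝ => F p.1 p.2)
      ((volume.restrict (Ioi 0)).prod (volume.restrict (Ioi a))) := by
    refine ((hk.comp_snd.ennreal_ofReal).mul ?_).mul ?_
    · exact Measurable.aemeasurable (by fun_prop)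
    · exact (hℓ.comp (measurable_snd.mul measurable_fst)).ennreal_ofReal.aemeasurable
  have hdil : ∀ B : Set ℝ, MeasurableSet B → ∀ y, a < y → ν ((fun z => y * z) '' B) =
      ENNReal.ofReal y * ∫⁻ z in Ioi 0, B.indicator (fun z => ENNReal.ofReal (ℓ (y * z))) z := by
    intro B hB y hy
    have hy0 : 0 < y := ha.trans_lt hy
    have himg : (fun z => y * z) '' B = (fun x => y⁻¹ * x) ⁻¹' B := by
      ext x
      constructor
      · rintro ⟨z, hz, rfl⟩
        simpa [hy0.ne'] using hz
      · intro hx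
        exact ⟨y⁻¹ * x, hx, by simp [hy0.ne']⟩
    have himg0 : (fun z => y * z) '' Ioi 0 = Ioi 0 := by
      simpa using image_mul_left_Ioi hy0 0
    have hm : MeasurableSet ((fun z => y * z) '' B) := by
      rw [himg]
      exact (measurable_const_mul y⁻¹) hB
    conv_lhs => rw [hd]
    have hcv := lintegral_image_eq_lintegral_abs_deriv_mul (measurableSet_Ioi (a := (0 : ℝ)))
      (f' := fun _ => y)
      (fun z _ => by simpa using ((hasDerivAt_id z).const_mul y).hasDerivWithinAt)
      (mul_right_injective₀ hy0.ne').injOn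
      (((fun z => y * z) '' B).indicator fun a => ENNReal.ofReal (ℓ a))
    rw [himg0] at hcv
    rw [withDensity_apply _ hm, ← lintegral_indicator hm, hcv, abs_of_pos hy0,
      lintegral_const_mul' _ _ ENNReal.ofReal_ne_top]
    congr 1
    refine lintegral_congr fun z => ?_
    have hiff : y * z ∈ (fun z => y * z) '' B ↔ z ∈ B :=
      (mul_right_injective₀ hy0.ne').mem_set_image
    by_cases hz : z ∈ B
    · rw [indicator_of_mem hz, indicator_of_mem (hiff.2 hz)]
    · rw [indicator_of_notMem hz, indicator_of_notMem (mt hiff.1 hz)]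
  have hmain : dilationMixture a k ν =
      (volume.restrict (Ioi 0)).withDensity (fun z => ∫⁻ y in Ioi a, F z y) := by
    ext B hB
    rw [dilationMixture_apply ha hk hB, withDensity_apply _ hB, ← lintegral_indicator hB]
    calc ∫⁻ y in Ioi a, ENNReal.ofReal (k y) * ν ((fun z => y * z) '' B)
        = ∫⁻ y in Ioi a, ∫⁻ z in Ioi 0, B.indicator (fun z => F z y) z := by
          refine setLIntegral_congr_fun measurableSet_Ioi fun y hy => ?_
          rw [hdil B hB y hy, ← mul_assoc, ← lintegral_const_mul' _ _
            (ENNReal.mul_ne_top ENNReal.ofReal_ne_top ENNReal.ofReal_ne_top)]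
          refine lintegral_congr fun z => ?_
          simp only [indicator, hF]
          split_ifs <;> simp
      _ = ∫⁻ z in Ioi 0, ∫⁻ y in Ioi a, B.indicator (fun z => F z y) z := by
          refine (lintegral_lintegral_swap ?_).symm
          have h := hFm.indicator (s := Prod.fst ⁻¹' B) (measurable_fst hB)
          exact h
      _ = ∫⁻ z in Ioi 0, B.indicator (fun z => ∫⁻ y in Ioi a, F z y) z := by
          refine lintegral_congr fun z => ?_
          by_cases hz : z ∈ B <;> simp [hz]
  have hDm : AEMeasurable (fun z => ∫⁻ y in Ioi a, F z y) (volume.restrict (Ioi 0)) :=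
    hFm.lintegral_prod_right'
  -- Finiteness comes from the mixture being a Lévy measure: its density times min z 1 has finite
  -- integral, and min z 1 > 0 for z > 0.
  have hfin : ∀ᵐ z ∂(volume.restrict (Ioi (0 : ℝ))), ∫⁻ y in Ioi a, F z y < ∞ := by
    have h1 := hL.lintegral_lt_top
    rw [hmain, lintegral_withDensity_eq_lintegral_mul₀ hDm (by fun_prop)] at h1
    have h2 := ae_lt_top' (hDm.mul (Measurable.aemeasurable (by fun_prop))) h1.ne
    filter_upwards [h2, ae_restrict_mem measurableSet_Ioi] with z hz hz0
    have hz0' : (0 : ℝ) < z := hz0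
    refine lt_top_iff_ne_top.2 fun htop => ?_
    simp only [Pi.mul_apply, htop] at hz
    rw [ENNReal.top_mul (by simp [hz0'])] at hz
    exact lt_irrefl _ hz
  have hgF : ∀ z, 0 < z → ∀ y, a < y → ENNReal.ofReal (c * g z y) = F z y := by
    intro z hz y hy
    have hy0 : 0 ≤ y := ha.trans hy.le
    rw [hg z hz y hy, ENNReal.ofReal_mul (mul_nonneg (hk0 y hy) hy0), ENNReal.ofReal_mul (hk0 y hy)]
  have hg0 : ∀ z, 0 < z → ∀ y, a < y → 0 ≤ c * g z y := by
    intro z hz y hy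
    have hy0 : 0 < y := ha.trans_lt hy
    rw [hg z hz y hy]
    exact mul_nonneg (mul_nonneg (hk0 y hy) hy0.le) (hℓ0 _ (by positivity))
  have hgm : ∀ z, 0 < z → AEStronglyMeasurable (fun y => c * g z y) (volume.restrict (Ioi a)) := by
    intro z hz
    refine AEMeasurable.aestronglyMeasurable (AEMeasurable.congr (f := fun y => k y * y * ℓ (y * z))
      ((hk.mul aemeasurable_id).mul (hℓ.comp (measurable_mul_const z)).aemeasurable) ?_)
    filter_upwards [ae_restrict_mem measurableSet_Ioi] with y hy using (hg z hz y hy).symm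
  constructor
  · filter_upwards [hfin, ae_restrict_mem measurableSet_Ioi] with z hz hz0
    have h1 : IntegrableOn (fun y => c * g z y) (Ioi a) := by
      refine ⟨hgm z hz0, ?_⟩
      rw [hasFiniteIntegral_iff_ofReal (ae_restrict_of_forall_mem measurableSet_Ioi (hg0 z hz0)),
        setLIntegral_congr_fun measurableSet_Ioi (hgF z hz0)]
      exact hz
    have h2 := h1.const_mul c⁻¹
    refine h2.congr (Filter.Eventually.of_forall fun y => ?_)
    simp [hc.ne']
  · rw [HasLevyDensity, hmain]
    refine withDensity_congr_ae ?_
    filter_upwards [hfin, ae_restrict_mem measurableSet_Ioi] with z hz hz0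
    rw [← integral_const_mul, integral_eq_lintegral_of_nonneg_ae
      (ae_restrict_of_forall_mem measurableSet_Ioi (hg0 z hz0)) (hgm z hz0),
      setLIntegral_congr_fun measurableSet_Ioi (hgF z hz0), ENNReal.ofReal_toReal hz.ne]

section Densities

variable {n : ℝ} {ν : Measure ℝ} {ℓ : ℝ → ℝ}

lemma hasLevyDensity_typeI (hn : 0 < n) (hν : IsLevyMeasure ν) (hℓ : Measurable ℓ)
    (hℓ0 : ∀ z, 0 < z → 0 ≤ ℓ z) (hd : HasLevyDensity ν ℓ) :
    (∀ᵐ z ∂(volume.restrict (Ioi (0 : ℝ))),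
        IntegrableOn (fun y => ℓ (y * z) / (y * invUpperGamma n (1 - 1 / y) ^ (n - 1)))
          (Ioi 1)) ∧
      HasLevyDensity (typeILevyMeasure n ν) (fun z => Real.Gamma n *
        ∫ y in Ioi 1, ℓ (y * z) / (y * invUpperGamma n (1 - 1 / y) ^ (n - 1))) := by
  have hG := Real.Gamma_pos_of_pos hn
  refine dilationMixture_hasLevyDensity zero_le_one hG ?_ ?_ hν (isLevyMeasure_typeI hn hν)
    hℓ hℓ0 hd ?_
  · have h1 := (aemeasurable_invUpperGamma hn).pow_const (n - 1)
    exact ((((measurable_id.pow_const 2).aemeasurable).mul h1).const_div 1).const_mul _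
  · intro y hy
    have hQ := Real.rpow_pos_of_pos (invUpperGamma_one_sub_one_div_pos hn hy) (n - 1)
    positivity
  · intro z hz y hy
    have hQ := Real.rpow_pos_of_pos (invUpperGamma_one_sub_one_div_pos hn hy) (n - 1)
    have hy0 : 0 < y := by linarith
    field_simp

lemma hasLevyDensity_typeII (hn : 0 < n) (hν : IsLevyMeasure ν) (hℓ : Measurable ℓ)
    (hℓ0 : ∀ z, 0 < z → 0 ≤ ℓ z) (hd : HasLevyDensity ν ℓ) :
    (∀ᵐ z ∂(volume.restrict (Ioi (0 : ℝ))),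
        IntegrableOn (fun y => Real.log y ^ (n - 1) * ℓ (y * z) / y) (Ioi 1)) ∧
      HasLevyDensity (typeIILevyMeasure n ν) (fun z => 1 / Real.Gamma n *
        ∫ y in Ioi 1, Real.log y ^ (n - 1) * ℓ (y * z) / y) := by
  have hG := Real.Gamma_pos_of_pos hn
  refine dilationMixture_hasLevyDensity zero_le_one (by positivity) ?_ ?_ hν
    (isLevyMeasure_typeII hn hν) hℓ hℓ0 hd ?_
  · exact Measurable.aemeasurable (by fun_prop)
  · intro y hy
    have hQ := Real.rpow_pos_of_pos (Real.log_pos hy) (n - 1)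
    positivity
  · intro z hz y hy
    have hy0 : 0 < y := by linarith
    field_simp

lemma hasLevyDensity_typeIII (hn : 0 < n) (hν : IsLevyMeasure ν) (hℓ : Measurable ℓ)
    (hℓ0 : ∀ z, 0 < z → 0 ≤ ℓ z) (hd : HasLevyDensity ν ℓ) :
    (∀ᵐ z ∂(volume.restrict (Ioi (0 : ℝ))),
        IntegrableOn (fun y => (Real.Gamma (n + 1) / y) ^ (1 / n) * (ℓ (y * z) / n))
          (Ioi (Real.Gamma (n + 1)))) ∧
      HasLevyDensity (typeIIILevyMeasure n ν) (fun z =>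
        ∫ y in Ioi (Real.Gamma (n + 1)),
          (Real.Gamma (n + 1) / y) ^ (1 / n) * (ℓ (y * z) / n)) := by
  have hG : 0 < Real.Gamma (n + 1) := Real.Gamma_pos_of_pos (by linarith)
  have h := dilationMixture_hasLevyDensity (c := 1)
    (g := fun z y => (Real.Gamma (n + 1) / y) ^ (1 / n) * (ℓ (y * z) / n)) hG.le one_pos
    (k := fun y => (Real.Gamma (n + 1) / y) ^ (1 / n) * (1 / (n * y)))
    (Measurable.aemeasurable (by fun_prop)) (fun y hy => ?_) hν
    (isLevyMeasure_typeIII hn hν) hℓ hℓ0 hd (fun z hz y hy => ?_)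
  · simp only [one_mul] at h
    exact h
  · have hy0 := hG.trans hy
    positivity
  · have hy0 := hG.trans hy
    field_simp

end Densities

/-! ### Integrals of subordinators against deterministic weights -/

/-- The tail `∫_t^1 g` of a function on `(0, 1)`. -/
def tailIntegral (g : ℝ → ℝ) (t : ℝ) : ℝ := ∫ s in Ioo 0 1, (Ioi t).indicator g s

lemma tailIntegral_eq {t : ℝ} (ht : 0 ≤ t) (g : ℝ → ℝ) : tailIntegral g t = ∫ s in Ioo t 1, g s := by
  rw [tailIntegral, setIntegral_indicator measurableSet_Ioi]
  congr 2
  ext s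
  simp only [mem_inter_iff, mem_Ioo, mem_Ioi]
  constructor
  · rintro ⟨⟨_, h1⟩, h2⟩
    exact ⟨h2, h1⟩
  · rintro ⟨h1, h2⟩
    exact ⟨⟨ht.trans_lt h1, h2⟩, h1⟩

section Tail

variable {g : ℝ → ℝ}

lemma tailIntegral_nonneg (hg0 : ∀ s ∈ Ioo (0 : ℝ) 1, 0 ≤ g s) (t : ℝ) : 0 ≤ tailIntegral g t := by
  refine setIntegral_nonneg measurableSet_Ioo fun s hs => ?_
  by_cases h : s ∈ Ioi t
  · rw [indicator_of_mem h]
    exact hg0 s hs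
  · rw [indicator_of_notMem h]

lemma antitone_tailIntegral (hg : IntegrableOn g (Ioo 0 1)) (hg0 : ∀ s ∈ Ioo (0 : ℝ) 1, 0 ≤ g s) :
    Antitone (tailIntegral g) := by
  intro t t' h
  refine setIntegral_mono_on (hg.indicator measurableSet_Ioi) (hg.indicator measurableSet_Ioi)
    measurableSet_Ioo fun s hs => ?_
  by_cases h' : s ∈ Ioi t'
  · rw [indicator_of_mem h', indicator_of_mem (show s ∈ Ioi t from h.trans_lt h')]
  · rw [indicator_of_notMem h']
    by_cases h'' : s ∈ Ioi t
    · rw [indicator_of_mem h'']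
      exact hg0 s hs
    · rw [indicator_of_notMem h'']

end Tail

/-- Left Riemann sums of an antitone function on `[0, 1]` converge to its integral. -/
lemma tendsto_sum_div_of_antitoneOn {F : ℝ → ℝ} (hF : AntitoneOn F (Icc 0 1)) :
    Filter.Tendsto (fun N : ℕ => (∑ i ∈ Finset.range N, F (i / N)) / N) Filter.atTop
      (nhds (∫ s in (0 : ℝ)..1, F s)) := by
  have hbounds : ∀ N : ℕ, 0 < N → (∫ s in (0 : ℝ)..1, F s) ≤ (∑ i ∈ Finset.range N, F (i / N)) / N ∧
      (∑ i ∈ Finset.range N, F (i / N)) / N ≤ (∫ s in (0 : ℝ)..1, F s) + (F 0 - F 1) / N := by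
    intro N hN
    have hN' : (0 : ℝ) < N := by exact_mod_cast hN
    have hA : AntitoneOn (fun x => F (x / N)) (Icc (0 : ℝ) (0 + (N : ℝ))) := by
      intro x hx y hy hxy
      rw [zero_add] at hx hy
      exact hF ⟨div_nonneg hx.1 hN'.le, (div_le_one hN').2 hx.2⟩
        ⟨div_nonneg hy.1 hN'.le, (div_le_one hN').2 hy.2⟩ (by gcongr)
    have hI : (∫ x in (0 : ℝ)..(0 + (N : ℝ)), F (x / N)) = N * ∫ s in (0 : ℝ)..1, F s := by
      rw [intervalIntegral.integral_comp_div F hN'.ne', smul_eq_mul]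
      simp [hN'.ne']
    have h1 := hA.integral_le_sum
    have h2 := hA.sum_le_integral
    rw [hI] at h1 h2
    simp only [zero_add] at h1 h2
    -- Splitting the sum over 0, …, N at either end shows that left and right sums differ by F 0 - F
    -- 1; the integral lies between them.
    have h3 := Finset.sum_range_succ' (fun i : ℕ => F ((i : ℝ) / N)) N
    have h4 := Finset.sum_range_succ (fun i : ℕ => F ((i : ℝ) / N)) N
    rw [h3] at h4
    simp only [Nat.cast_zero, zero_div, div_self hN'.ne'] at h4
    constructor
    · rw [le_div_iff₀ hN']
      linarith
    · rw [div_le_iff₀ hN', add_mul, div_mul_cancel₀ _ hN'.ne']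
      linarith
  have hlim : Filter.Tendsto (fun N : ℕ => (∫ s in (0 : ℝ)..1, F s) + (F 0 - F 1) / N)
      Filter.atTop (nhds (∫ s in (0 : ℝ)..1, F s)) := by
    simpa using (tendsto_const_div_atTop_nhds_zero_nat (F 0 - F 1)).const_add
      (∫ s in (0 : ℝ)..1, F s)
  refine tendsto_of_tendsto_of_tendsto_of_le_of_le' tendsto_const_nhds hlim ?_ ?_
  · filter_upwards [Filter.eventually_gt_atTop 0] with N hN using (hbounds N hN).1
  · filter_upwards [Filter.eventually_gt_atTop 0] with N hN using (hbounds N hN).2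

/-- The weighted integral `∫_0^1 X_s g(s) ds` of a process. -/
def pathIntegral {Ω : Type*} (X : ℝ≥0 → Ω → ℝ) (g : ℝ → ℝ) (ω : Ω) : ℝ :=
  ∫ s in Ioo 0 1, X s.toNNReal ω * g s

/-- The increment of a process over `[i / N, (i + 1) / N]`. -/
def gridIncrement {Ω : Type*} (X : ℝ≥0 → Ω → ℝ) (N i : ℕ) (ω : Ω) : ℝ :=
  X (((i + 1 : ℕ) : ℝ≥0) / N) ω - X ((i : ℝ≥0) / N) ω

/-- The Riemann sums that approximate `pathIntegral X g`. -/
def gridSum {Ω : Type*} (X : ℝ≥0 → Ω → ℝ) (g : ℝ → ℝ) (N : ℕ) (ω : Ω) : ℝ :=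
  ∑ i ∈ Finset.range N, gridIncrement X N i ω * tailIntegral g (i / N)

lemma sum_gridIncrement {Ω : Type*} (X : ℝ≥0 → Ω → ℝ) (N k : ℕ) (ω : Ω) :
    ∑ i ∈ Finset.range k, gridIncrement X N i ω = X ((k : ℝ≥0) / N) ω - X 0 ω := by
  have := Finset.sum_range_sub (fun i : ℕ => X ((i : ℝ≥0) / N) ω) k
  simpa [gridIncrement] using this

/-- Summation by parts: X at ⌈sN⌉/N is the sum of the increments with i/N < s, and integrating the
indicator of s > i/N against g gives the tail of g at i/N. -/
lemma gridSum_eq_integral {Ω : Type*} {X : ℝ≥0 → Ω → ℝ} {g : ℝ → ℝ} (hg : IntegrableOn g (Ioo 0 1))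
    {N : ℕ} (hN : 0 < N) {ω : Ω} (h0 : X 0 ω = 0) :
    gridSum X g N ω = ∫ s in Ioo (0 : ℝ) 1, X ((⌈s * N⌉₊ : ℝ≥0) / N) ω * g s := by
  have hN' : (0 : ℝ) < N := by exact_mod_cast hN
  have h : ∀ s ∈ Ioo (0 : ℝ) 1, X ((⌈s * N⌉₊ : ℝ≥0) / N) ω * g s =
      ∑ i ∈ Finset.range N, gridIncrement X N i ω * (Ioi ((i : ℝ) / N)).indicator g s := by
    intro s hs
    have hle : ⌈s * N⌉₊ ≤ N := Nat.ceil_le.2 (by nlinarith [hs.2])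
    have h1 := sum_gridIncrement X N ⌈s * N⌉₊ ω
    rw [h0, sub_zero] at h1
    rw [← h1, Finset.sum_mul]
    rw [← Finset.sum_subset (Finset.range_subset_range.2 hle)]
    · refine Finset.sum_congr rfl fun i hi => ?_
      rw [indicator_of_mem]
      rw [Finset.mem_range, Nat.lt_ceil] at hi
      rwa [mem_Ioi, div_lt_iff₀ hN']
    · intro i _ hi
      rw [indicator_of_notMem, mul_zero]
      rw [Finset.mem_range, Nat.lt_ceil] at hi
      rwa [mem_Ioi, div_lt_iff₀ hN']
  rw [setIntegral_congr_fun measurableSet_Ioo h, integral_finsetSum _ fun i _ =>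
    (hg.indicator measurableSet_Ioi).const_mul _, gridSum]
  refine Finset.sum_congr rfl fun i _ => ?_
  rw [integral_const_mul, tailIntegral]

/-- The grid points ⌈sN⌉/N tend to s from above, so right-continuity suffices; monotonicity of the
path gives the dominating function X₁ |g|. -/
lemma tendsto_gridSum {Ω : Type*} {X : ℝ≥0 → Ω → ℝ} {g : ℝ → ℝ} (hg : IntegrableOn g (Ioo 0 1))
    {ω : Ω} (h0 : X 0 ω = 0) (hmono : Monotone fun t => X t ω)
    (hcont : ∀ t, ContinuousWithinAt (fun s => X s ω) (Ici t) t) :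
    Filter.Tendsto (fun N => gridSum X g N ω) Filter.atTop (nhds (pathIntegral X g ω)) := by
  have hlim : Filter.Tendsto (fun N : ℕ => ∫ s in Ioo (0 : ℝ) 1, X ((⌈s * N⌉₊ : ℝ≥0) / N) ω * g s)
      Filter.atTop (nhds (pathIntegral X g ω)) := by
    refine tendsto_integral_filter_of_dominated_convergence (fun s => X 1 ω * ‖g s‖) ?_ ?_
      (hg.norm.const_mul _) ?_
    · refine Filter.Eventually.of_forall fun N => ?_
      refine AEStronglyMeasurable.mul (Measurable.aestronglyMeasurable
        (Monotone.measurable (f := fun s : ℝ => X ((⌈s * N⌉₊ : ℝ≥0) / N) ω) ?_))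
        hg.aestronglyMeasurable
      intro s t hst
      refine hmono ?_
      gcongr
    · filter_upwards [Filter.eventually_gt_atTop 0] with N hN
      refine ae_restrict_of_forall_mem measurableSet_Ioo fun s hs => ?_
      have hN' : (0 : ℝ≥0) < N := by exact_mod_cast hN
      have hN'' : (0 : ℝ) < N := by exact_mod_cast hN
      have hle : ⌈s * N⌉₊ ≤ N := Nat.ceil_le.2 (by nlinarith [hs.2])
      have hX0 : 0 ≤ X ((⌈s * N⌉₊ : ℝ≥0) / N) ω := h0 ▸ hmono (zero_le)
      rw [norm_mul, Real.norm_of_nonneg hX0]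
      refine mul_le_mul_of_nonneg_right (hmono ?_) (norm_nonneg _)
      rw [div_le_one hN']
      exact_mod_cast hle
    · refine ae_restrict_of_forall_mem measurableSet_Ioo fun s hs => ?_
      refine Filter.Tendsto.mul_const _ ?_
      have ht : Filter.Tendsto (fun N : ℕ => (⌈s * N⌉₊ : ℝ≥0) / N) Filter.atTop
          (nhdsWithin s.toNNReal (Ici s.toNNReal)) := by
        refine tendsto_nhdsWithin_iff.2 ⟨?_, ?_⟩
        · rw [← NNReal.tendsto_coe, Real.coe_toNNReal s hs.1.le]
          push_cast
          exact (tendsto_nat_ceil_mul_div_atTop hs.1.le).comp tendsto_natCast_atTop_atTop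
        · filter_upwards [Filter.eventually_gt_atTop 0] with N hN
          have hN'' : (0 : ℝ) < N := by exact_mod_cast hN
          rw [mem_Ici, ← NNReal.coe_le_coe, Real.coe_toNNReal s hs.1.le]
          push_cast
          rw [le_div_iff₀ hN'']
          exact Nat.le_ceil _
      exact (hcont s.toNNReal).tendsto.comp ht
  refine hlim.congr' ?_
  filter_upwards [Filter.eventually_gt_atTop 0] with N hN using (gridSum_eq_integral hg hN h0).symm

/-! ### Laplace transforms of weighted integrals of a subordinator -/

section Subordinator

variable {Ω : Type*} [MeasurableSpace Ω] {P : Measure Ω} {X : ℝ≥0 → Ω → ℝ}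

/-- The cumulant `u ↦ -log E exp (-u X₁)`. -/
def laplaceExponent (P : Measure Ω) (X : ℝ≥0 → Ω → ℝ) (u : ℝ) : ℝ :=
  -Real.log (mgf (X 1) P (-u))

lemma IsSubordinator.ae_nonneg (hX : IsSubordinator P X) : ∀ᵐ ω ∂P, ∀ t, 0 ≤ X t ω := by
  filter_upwards [hX.zero, hX.paths] with ω h0 hp t
  exact h0 ▸ hp.1 zero_le

lemma integrable_exp_neg_mul [IsProbabilityMeasure P] {A : Ω → ℝ} (hA : AEMeasurable A P)
    (h0 : ∀ᵐ ω ∂P, 0 ≤ A ω) {u : ℝ} (hu : 0 ≤ u) : Integrable (fun ω => Real.exp (-u * A ω)) P := by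
  refine Integrable.of_bound (C := 1) (by fun_prop) ?_
  filter_upwards [h0] with ω hω
  rw [Real.norm_of_nonneg (Real.exp_pos _).le, Real.exp_le_one_iff]
  nlinarith [mul_nonneg hu hω]

lemma IsSubordinator.mgf_pos (hX : IsSubordinator P X) (t : ℝ≥0) {u : ℝ} (hu : 0 ≤ u) :
    0 < mgf (X t) P (-u) := by
  have := hX.isProbabilityMeasure
  exact ProbabilityTheory.mgf_pos (integrable_exp_neg_mul (hX.measurable t).aemeasurable
    (hX.ae_nonneg.mono fun ω h => h t) hu)

lemma IsSubordinator.mgf_one (hX : IsSubordinator P X) {u : ℝ} (hu : 0 ≤ u) :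
    mgf (X 1) P (-u) = Real.exp (-laplaceExponent P X u) := by
  rw [laplaceExponent, neg_neg, Real.exp_log (hX.mgf_pos 1 hu)]

lemma IsSubordinator.monotoneOn_laplaceExponent (hX : IsSubordinator P X) :
    MonotoneOn (laplaceExponent P X) (Ici 0) := by
  intro u hu v hv huv
  have := hX.isProbabilityMeasure
  have h0 := hX.ae_nonneg.mono fun ω h => h 1
  have hm := (hX.measurable 1).aemeasurable (μ := P)
  refine neg_le_neg (Real.log_le_log (hX.mgf_pos 1 hv) (integral_mono_ae
    (integrable_exp_neg_mul hm h0 hv) (integrable_exp_neg_mul hm h0 hu) ?_))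
  filter_upwards [h0] with ω hω
  refine Real.exp_le_exp.2 ?_
  nlinarith

lemma IsSubordinator.measurable_gridIncrement (hX : IsSubordinator P X) (N i : ℕ) :
    Measurable (gridIncrement X N i) :=
  (hX.measurable _).sub (hX.measurable _)

lemma IsSubordinator.iIndepFun_gridIncrement (hX : IsSubordinator P X) (N : ℕ) :
    iIndepFun (gridIncrement X N) P :=
  hX.indep.nat (t := fun i : ℕ => (i : ℝ≥0) / N) fun i j hij => by
    simp only
    gcongr

lemma IsSubordinator.mgf_gridIncrement (hX : IsSubordinator P X) (N i : ℕ) (t : ℝ) :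
    mgf (gridIncrement X N i) P t = mgf (X (1 / N)) P t := by
  have h := hX.stationary ((i : ℝ≥0) / N) (1 / N)
  have h1 : (i : ℝ≥0) / N + 1 / N = ((i + 1 : ℕ) : ℝ≥0) / N := by
    push_cast
    rw [add_div]
  rw [h1] at h
  rw [← mgf_id_map h.aemeasurable_snd, ← h.map_eq, mgf_id_map h.aemeasurable_fst]
  rfl

/-- X₁ is a sum of N independent copies of X at time 1/N, and positive N-th roots are unique. -/
lemma IsSubordinator.mgf_one_div (hX : IsSubordinator P X) {N : ℕ} (hN : 0 < N) {u : ℝ}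
    (hu : 0 ≤ u) : mgf (X (1 / N)) P (-u) = Real.exp (-laplaceExponent P X u / N) := by
  have hN' : (N : ℝ) ≠ 0 := by exact_mod_cast hN.ne'
  have hN'' : (N : ℝ≥0) ≠ 0 := by exact_mod_cast hN.ne'
  have h1 : mgf (X 1) P (-u) = mgf (X (1 / N)) P (-u) ^ N := by
    have h2 := (hX.iIndepFun_gridIncrement N).mgf_sum (t := -u) (hX.measurable_gridIncrement N)
      (Finset.range N)
    simp_rw [hX.mgf_gridIncrement] at h2
    rw [Finset.prod_const, Finset.card_range] at h2
    rw [← h2]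
    refine mgf_congr ?_
    filter_upwards [hX.zero] with ω h0
    rw [Finset.sum_apply, sum_gridIncrement, h0, sub_zero, div_self hN'']
  rw [hX.mgf_one hu] at h1
  refine (pow_left_inj₀ (hX.mgf_pos _ hu).le (Real.exp_pos _).le hN.ne').1 ?_
  rw [← h1, ← Real.exp_nat_mul]
  congr 1
  field_simp

/-- By independence the exponents add up, to a left Riemann sum of s ↦ Φ(u G(s)). -/
lemma IsSubordinator.mgf_gridSum (hX : IsSubordinator P X) {g : ℝ → ℝ}
    (hg0 : ∀ s ∈ Ioo (0 : ℝ) 1, 0 ≤ g s) {N : ℕ} (hN : 0 < N) {u : ℝ} (hu : 0 ≤ u) :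
    mgf (gridSum X g N) P (-u) = Real.exp (-((∑ i ∈ Finset.range N,
      laplaceExponent P X (u * tailIntegral g (i / N))) / N)) := by
  have hsum : gridSum X g N = ∑ i ∈ Finset.range N,
      fun ω => gridIncrement X N i ω * tailIntegral g (i / N) := by
    funext ω
    rw [gridSum, Finset.sum_apply]
  have hind : iIndepFun (fun i ω => gridIncrement X N i ω * tailIntegral g ((i : ℝ) / N)) P :=
    (hX.iIndepFun_gridIncrement N).comp (fun i x => x * tailIntegral g ((i : ℝ) / N))
      fun i => measurable_mul_const _
  rw [hsum, hind.mgf_sum fun i => (hX.measurable_gridIncrement N i).mul_const _, Finset.sum_div,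
    ← Finset.sum_neg_distrib, Real.exp_sum]
  refine Finset.prod_congr rfl fun i _ => ?_
  have ht := tailIntegral_nonneg hg0 ((i : ℝ) / N)
  rw [← neg_div, ← hX.mgf_one_div hN (mul_nonneg hu ht), ← hX.mgf_gridIncrement N i, mgf, mgf]
  refine integral_congr_ae (Filter.Eventually.of_forall fun ω => ?_)
  simp only
  ring_nf

lemma IsSubordinator.ae_tendsto_gridSum (hX : IsSubordinator P X) {g : ℝ → ℝ}
    (hg : IntegrableOn g (Ioo 0 1)) : ∀ᵐ ω ∂P, Filter.Tendsto (fun N => gridSum X g N ω)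
      Filter.atTop (nhds (pathIntegral X g ω)) := by
  filter_upwards [hX.zero, hX.paths] with ω h0 hp using tendsto_gridSum hg h0 hp.1 hp.2

lemma IsSubordinator.measurable_gridSum (hX : IsSubordinator P X) (g : ℝ → ℝ) (N : ℕ) :
    Measurable (gridSum X g N) := by
  unfold gridSum
  exact Finset.measurable_sum _ fun i _ => (hX.measurable_gridIncrement N i).mul_const _

lemma IsSubordinator.aemeasurable_pathIntegral (hX : IsSubordinator P X) {g : ℝ → ℝ}
    (hg : IntegrableOn g (Ioo 0 1)) : AEMeasurable (pathIntegral X g) P :=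
  aemeasurable_of_tendsto_metrizable_ae Filter.atTop
    (fun N => (hX.measurable_gridSum g N).aemeasurable) (hX.ae_tendsto_gridSum hg)

lemma IsSubordinator.pathIntegral_nonneg (hX : IsSubordinator P X) {g : ℝ → ℝ}
    (hg0 : ∀ s ∈ Ioo (0 : ℝ) 1, 0 ≤ g s) : ∀ᵐ ω ∂P, 0 ≤ pathIntegral X g ω := by
  filter_upwards [hX.ae_nonneg] with ω h
  exact setIntegral_nonneg measurableSet_Ioo fun s hs => mul_nonneg (h _) (hg0 s hs)

/-- The Laplace transform of a weighted integral of a subordinator. -/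
lemma IsSubordinator.mgf_pathIntegral (hX : IsSubordinator P X) {g : ℝ → ℝ}
    (hg : IntegrableOn g (Ioo 0 1)) (hg0 : ∀ s ∈ Ioo (0 : ℝ) 1, 0 ≤ g s) {u : ℝ} (hu : 0 ≤ u) :
    mgf (pathIntegral X g) P (-u) =
      Real.exp (-∫ s in (0 : ℝ)..1, laplaceExponent P X (u * tailIntegral g s)) := by
  have := hX.isProbabilityMeasure
  have h1 : Filter.Tendsto (fun N => mgf (gridSum X g N) P (-u)) Filter.atTop
      (nhds (mgf (pathIntegral X g) P (-u))) := by
    refine tendsto_integral_of_dominated_convergence (fun _ => 1) (fun N => ?_)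
      (integrable_const _) (fun N => ?_) ?_
    · have := hX.measurable_gridSum g N
      exact Measurable.aestronglyMeasurable (by fun_prop)
    · filter_upwards [hX.paths] with ω hω
      rw [Real.norm_of_nonneg (Real.exp_pos _).le, Real.exp_le_one_iff]
      have : 0 ≤ gridSum X g N ω := Finset.sum_nonneg fun i _ =>
        mul_nonneg (sub_nonneg.2 (hω.1 (by gcongr; simp))) (tailIntegral_nonneg hg0 _)
      nlinarith [mul_nonneg hu this]
    · filter_upwards [hX.ae_tendsto_gridSum hg] with ω hω
      exact (Real.continuous_exp.tendsto _).comp (hω.const_mul _)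
  -- Monotonicity of Φ and of the tail makes the Riemann sums converge without any continuity of Φ.
  have hA : AntitoneOn (fun s => laplaceExponent P X (u * tailIntegral g s)) (Icc 0 1) := by
    intro s _ t _ hst
    refine hX.monotoneOn_laplaceExponent (mul_nonneg hu (tailIntegral_nonneg hg0 _))
      (mul_nonneg hu (tailIntegral_nonneg hg0 _)) ?_
    exact mul_le_mul_of_nonneg_left (antitone_tailIntegral hg hg0 hst) hu
  have h2 := (Real.continuous_exp.tendsto _).comp (tendsto_sum_div_of_antitoneOn hA).neg
  refine tendsto_nhds_unique h1 (h2.congr' ?_)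
  filter_upwards [Filter.eventually_gt_atTop 0] with N hN
  exact (hX.mgf_gridSum hg0 hN hu).symm

end Subordinator

/-! ### Iterated averages and iterated integrals of a path -/

lemma intervalIntegral_eq_Ioo {t : ℝ} (ht : 0 ≤ t) (f : ℝ → ℝ) :
    ∫ s in (0 : ℝ)..t, f s = ∫ s in Ioo 0 t, f s := by
  rw [intervalIntegral.integral_of_le ht, integral_Ioc_eq_integral_Ioo]

/-- Fubini's theorem on a triangle. -/
lemma integral_Ioo_integral_Ioo {t C : ℝ} {K : ℝ → ℝ → ℝ} {J f : ℝ → ℝ}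
    (hK : Measurable fun p : ℝ × ℝ => K p.1 p.2) (hf : Measurable f)
    (hK0 : ∀ r s, 0 < r → r < s → s < t → 0 ≤ K s r) (hf0 : ∀ r, 0 ≤ f r)
    (hfC : ∀ r, 0 < r → r < t → f r ≤ C)
    (hKi : ∀ r, 0 < r → r < t → IntegrableOn (fun s => K s r) (Ioo r t))
    (hJ : ∀ r, 0 < r → r < t → ∫ s in Ioo r t, K s r = J r) (hJi : IntegrableOn J (Ioo 0 t)) :
    ∫ s in Ioo 0 t, ∫ r in Ioo 0 s, K s r * f r = ∫ r in Ioo 0 t, J r * f r := by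
  set T : Set (ℝ × ℝ) := {p | p.2 < p.1} with hT
  have hTm : MeasurableSet T := measurableSet_lt measurable_snd measurable_fst
  set φ : ℝ × ℝ → ℝ := T.indicator fun p => K p.1 p.2 * f p.2 with hφ
  have hφm : Measurable φ := (hK.mul (hf.comp measurable_snd)).indicator hTm
  have hr : ∀ r ∈ Ioo 0 t, (fun s => φ (s, r)) = (Ioi r).indicator fun s => K s r * f r := by
    intro r _
    funext s
    simp [hφ, hT, indicator]
  have hset : ∀ r ∈ Ioo 0 t, Ioo 0 t ∩ Ioi r = Ioo r t := by
    intro r hr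
    ext s
    simp only [mem_inter_iff, mem_Ioo, mem_Ioi]
    exact ⟨fun h => ⟨h.2, h.1.2⟩, fun h => ⟨⟨hr.1.trans h.1, h.2⟩, h.1⟩⟩
  have hint : ∀ r ∈ Ioo 0 t, ∫ s in Ioo 0 t, φ (s, r) = J r * f r := by
    intro r hr'
    rw [hr r hr', setIntegral_indicator measurableSet_Ioi, hset r hr', integral_mul_const,
      hJ r hr'.1 hr'.2]
  -- As φ ≥ 0 on the square, the inner integral of its norm is J(r) f(r), which is dominated by C
  -- |J|.
  have hintegrable : Integrable φ ((volume.restrict (Ioo 0 t)).prod (volume.restrict (Ioo 0 t))) := by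
    refine (integrable_prod_iff' hφm.aestronglyMeasurable).2 ⟨?_, ?_⟩
    · refine ae_restrict_of_forall_mem measurableSet_Ioo fun r hr' => ?_
      rw [hr r hr', integrable_indicator_iff measurableSet_Ioi, IntegrableOn,
        Measure.restrict_restrict measurableSet_Ioi, inter_comm, hset r hr']
      exact (hKi r hr'.1 hr'.2).mul_const _
    · refine Integrable.congr (f := fun r => J r * f r) ?_ ?_
      · refine Integrable.mono' (hJi.norm.mul_const C)
          (hJi.aestronglyMeasurable.mul hf.aestronglyMeasurable) ?_
        refine ae_restrict_of_forall_mem measurableSet_Ioo fun r hr' => ?_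
        rw [norm_mul, Real.norm_of_nonneg (hf0 r)]
        exact mul_le_mul_of_nonneg_left (hfC r hr'.1 hr'.2) (norm_nonneg _)
      · refine (ae_restrict_of_forall_mem measurableSet_Ioo fun r hr' => ?_)
        refine (hint r hr').symm.trans ?_
        refine setIntegral_congr_fun measurableSet_Ioo fun s hs => ?_
        refine (Real.norm_of_nonneg ?_).symm
        by_cases h : (s, r) ∈ T
        · rw [hφ, indicator_of_mem h]
          exact mul_nonneg (hK0 r s hr'.1 h hs.2) (hf0 r)
        · rw [hφ, indicator_of_notMem h]
  calc ∫ s in Ioo 0 t, ∫ r in Ioo 0 s, K s r * f r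
      = ∫ s in Ioo 0 t, ∫ r in Ioo 0 t, φ (s, r) := by
        refine setIntegral_congr_fun measurableSet_Ioo fun s hs => ?_
        have h1 : (fun r => φ (s, r)) = (Iio s).indicator fun r => K s r * f r := by
          funext r
          simp [hφ, hT, indicator]
        have h2 : Ioo 0 t ∩ Iio s = Ioo 0 s := by
          ext r
          simp only [mem_inter_iff, mem_Ioo, mem_Iio]
          exact ⟨fun h => ⟨h.1.1, h.2⟩, fun h => ⟨⟨h.1, h.2.trans hs.2⟩, h.2⟩⟩
        rw [h1, setIntegral_indicator measurableSet_Iio, h2]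
    _ = ∫ r in Ioo 0 t, ∫ s in Ioo 0 t, φ (s, r) := integral_integral_swap hintegrable
    _ = ∫ r in Ioo 0 t, J r * f r := setIntegral_congr_fun measurableSet_Ioo hint

/-- The mean of degree `p` of a function: `(t Γ(p))⁻¹ ∫₀ᵗ f(s) log^{p-1} (t / s) ds`. -/
def logMean (p : ℝ) (f : ℝ → ℝ) (t : ℝ) : ℝ :=
  (t * Real.Gamma p)⁻¹ * ∫ s in (0 : ℝ)..t, f s * Real.log (t / s) ^ (p - 1)

/-- The Riemann–Liouville integral of degree `p` of a function. -/
def fracIntegral (p : ℝ) (f : ℝ → ℝ) (t : ℝ) : ℝ :=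
  (Real.Gamma p)⁻¹ * ∫ s in (0 : ℝ)..t, (t - s) ^ (p - 1) * f s

lemma logMean_one (f : ℝ → ℝ) (t : ℝ) : logMean 1 f t = t⁻¹ * ∫ s in (0 : ℝ)..t, f s := by
  simp [logMean]

lemma fracIntegral_one (f : ℝ → ℝ) (t : ℝ) : fracIntegral 1 f t = ∫ s in (0 : ℝ)..t, f s := by
  simp [fracIntegral]

lemma integrableOn_log_div_rpow {p t : ℝ} (hp : 0 < p) (ht : 0 < t) :
    IntegrableOn (fun r => Real.log (t / r) ^ (p - 1)) (Ioo 0 t) := by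
  have h1 : IntervalIntegrable (fun s : ℝ => (-Real.log s) ^ (p - 1)) volume 0 1 :=
    (intervalIntegrable_iff_integrableOn_Ioo_of_le zero_le_one).2 (integrableOn_neg_log_rpow hp).1
  have h2 := h1.comp_mul_right (c := t⁻¹)
  rw [zero_div, one_div, inv_inv, intervalIntegrable_iff_integrableOn_Ioo_of_le ht.le] at h2
  refine h2.congr_fun (fun r hr => ?_) measurableSet_Ioo
  simp only
  rw [← Real.log_inv, mul_inv, inv_inv, mul_comm, div_eq_mul_inv]

/-- After exchanging the integrals, the inner one is that of log(s/r)^{p-1} / (s Γ(p)) over r < s <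
t, with primitive log(s/r)^p / Γ(p+1). The condition p ≥ 1 keeps the kernel continuous up to s = r.
-/
lemma logMean_succ {p t : ℝ} (hp : 1 ≤ p) (ht : 0 < t) {f : ℝ → ℝ} (hf : Monotone f)
    (hf0 : ∀ r, 0 ≤ f r) : t⁻¹ * ∫ s in (0 : ℝ)..t, logMean p f s = logMean (p + 1) f t := by
  have hp0 : 0 < p := by linarith
  have hG := Real.Gamma_pos_of_pos hp0
  have hder : ∀ r s, 0 < r → r ≤ s → HasDerivAt (fun s => Real.log (s / r) ^ p / Real.Gamma (p + 1))
      ((s * Real.Gamma p)⁻¹ * Real.log (s / r) ^ (p - 1)) s := by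
    intro r s hr hrs
    have hs := hr.trans_le hrs
    have h1 : HasDerivAt (fun s => Real.log (s / r)) s⁻¹ s := by
      convert! ((hasDerivAt_id s).div_const r).log (div_ne_zero hs.ne' hr.ne') using 1
      simp only [id]
      field_simp
    convert! (h1.rpow_const (p := p) (Or.inr hp)).div_const (Real.Gamma (p + 1)) using 1
    rw [Real.Gamma_add_one hp0.ne']
    field_simp
  have hKint : ∀ r, 0 < r → r < t → IntervalIntegrable
      (fun s => (s * Real.Gamma p)⁻¹ * Real.log (s / r) ^ (p - 1)) volume r t := by
    intro r hr hrt
    refine ContinuousOn.intervalIntegrable_of_Icc hrt.le fun s hs => ?_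
    have hs0 : 0 < s := hr.trans_le hs.1
    refine ContinuousAt.continuousWithinAt (ContinuousAt.mul ?_ ?_)
    · exact (continuousAt_id.mul_const _).inv₀ (mul_ne_zero hs0.ne' hG.ne')
    · exact ((continuousAt_id.div_const r).log (div_ne_zero hs0.ne' hr.ne')).rpow_const
        (Or.inr (by linarith))
  have hmain := integral_Ioo_integral_Ioo (t := t) (C := f t) (f := f)
    (K := fun s r => (s * Real.Gamma p)⁻¹ * Real.log (s / r) ^ (p - 1))
    (J := fun r => Real.log (t / r) ^ p / Real.Gamma (p + 1)) (by fun_prop) hf.measurable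
    (fun r s hr hrs _ => ?_) hf0 (fun r _ h => hf h.le)
    (fun r hr hrt => (intervalIntegrable_iff_integrableOn_Ioo_of_le hrt.le).1 (hKint r hr hrt))
    (fun r hr hrt => ?_) ?_
  · rw [logMean, add_sub_cancel_right, intervalIntegral_eq_Ioo ht.le, intervalIntegral_eq_Ioo ht.le,
      mul_inv, mul_assoc]
    congr 1
    rw [← integral_const_mul]
    convert hmain using 1
    · refine setIntegral_congr_fun measurableSet_Ioo fun s hs => ?_
      rw [logMean, intervalIntegral_eq_Ioo hs.1.le, ← integral_const_mul]
      congr 1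
      funext r
      ring
    · congr 1
      funext r
      ring
  · have h1 : 1 ≤ s / r := (one_le_div hr).2 hrs.le
    have h2 := Real.rpow_nonneg (Real.log_nonneg h1) (p - 1)
    have h3 : 0 < s := hr.trans hrs
    positivity
  · rw [← integral_Ioc_eq_integral_Ioo, ← intervalIntegral.integral_of_le hrt.le,
      intervalIntegral.integral_eq_sub_of_hasDerivAt (f := fun s =>
        Real.log (s / r) ^ p / Real.Gamma (p + 1)) (fun s hs => ?_) (hKint r hr hrt)]
    · simp [hr.ne', hp0.ne']
    · rw [uIcc_of_le hrt.le] at hs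
      exact hder r s hr hs.1
  · have h := (integrableOn_log_div_rpow (p := p + 1) (by linarith) ht).div_const (Real.Gamma (p + 1))
    rwa [add_sub_cancel_right] at h

/-- The same exchange as in `logMean_succ`, with primitive (s - r)^p / Γ(p+1). -/
lemma fracIntegral_succ {p t : ℝ} (hp : 1 ≤ p) (ht : 0 < t) {f : ℝ → ℝ} (hf : Monotone f)
    (hf0 : ∀ r, 0 ≤ f r) : ∫ s in (0 : ℝ)..t, fracIntegral p f s = fracIntegral (p + 1) f t := by
  have hp0 : 0 < p := by linarith
  have hG := Real.Gamma_pos_of_pos hp0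
  have hder : ∀ r s, HasDerivAt (fun s => (s - r) ^ p / Real.Gamma (p + 1))
      ((Real.Gamma p)⁻¹ * (s - r) ^ (p - 1)) s := by
    intro r s
    convert! (((hasDerivAt_id s).sub_const r).rpow_const (p := p) (Or.inr hp)).div_const
      (Real.Gamma (p + 1)) using 1
    rw [Real.Gamma_add_one hp0.ne']
    simp only [id]
    field_simp
  have hcont : ∀ r, Continuous fun s : ℝ => (Real.Gamma p)⁻¹ * (s - r) ^ (p - 1) := fun r =>
    continuous_const.mul ((continuous_id.sub continuous_const).rpow_const
      fun s => Or.inr (by linarith))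
  have hmain := integral_Ioo_integral_Ioo (t := t) (C := f t) (f := f)
    (K := fun s r => (Real.Gamma p)⁻¹ * (s - r) ^ (p - 1))
    (J := fun r => (t - r) ^ p / Real.Gamma (p + 1)) (by fun_prop) hf.measurable
    (fun r s hr hrs _ => ?_) hf0 (fun r _ h => hf h.le)
    (fun r hr hrt => (intervalIntegrable_iff_integrableOn_Ioo_of_le hrt.le).1
      ((hcont r).intervalIntegrable _ _))
    (fun r hr hrt => ?_) ?_
  · rw [fracIntegral, add_sub_cancel_right, intervalIntegral_eq_Ioo ht.le,
      intervalIntegral_eq_Ioo ht.le, ← integral_const_mul]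
    convert hmain using 1
    · refine setIntegral_congr_fun measurableSet_Ioo fun s hs => ?_
      rw [fracIntegral, intervalIntegral_eq_Ioo hs.1.le, ← integral_const_mul]
      congr 1
      funext r
      ring
    · congr 1
      funext r
      ring
  · have h2 := Real.rpow_nonneg (sub_nonneg.2 hrs.le) (p - 1)
    positivity
  · rw [← integral_Ioc_eq_integral_Ioo, ← intervalIntegral.integral_of_le hrt.le,
      intervalIntegral.integral_eq_sub_of_hasDerivAt (f := fun s =>
        (s - r) ^ p / Real.Gamma (p + 1)) (fun s _ => hder r s) ((hcont r).intervalIntegrable _ _)]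
    simp [hp0.ne']
  · have h : Continuous fun r : ℝ => (t - r) ^ p / Real.Gamma (p + 1) :=
      ((continuous_const.sub continuous_id).rpow_const fun s => Or.inr hp0.le).div_const _
    exact (intervalIntegrable_iff_integrableOn_Ioo_of_le ht.le).1 (h.intervalIntegrable _ _)

/-- Rescaling to (0, 1) exhibits the mixing law of type II. -/
lemma logMean_eq_integral_logWeight {p t : ℝ} (ht : 0 < t) (f : ℝ → ℝ) :
    logMean p f t = ∫ s in Ioo 0 1, logWeight p s * f (s * t) := by
  have h := intervalIntegral.integral_comp_mul_right (a := 0) (b := 1)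
    (fun s => f s * Real.log (t / s) ^ (p - 1)) ht.ne'
  rw [zero_mul, one_mul, smul_eq_mul] at h
  rw [logMean, mul_inv, mul_right_comm, ← h, mul_comm, ← intervalIntegral_eq_Ioo zero_le_one,
    ← intervalIntegral.integral_const_mul]
  refine intervalIntegral.integral_congr fun s _ => ?_
  simp only [logWeight]
  rw [← Real.log_inv, show t / (s * t) = s⁻¹ by field_simp]
  ring

/-! ### Averages along a single path -/

section Paths

variable {Ω : Type*} {X : ℝ≥0 → Ω → ℝ} {ω : Ω}

lemma repeatedAverage_succ (hmono : Monotone fun t => X t ω) (h0 : ∀ t, 0 ≤ X t ω) (m : ℕ)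
    (t : ℝ≥0) :
    repeatedAverage X (m + 1) t ω = logMean ((m + 1 : ℕ) : ℝ) (fun s => X s.toNNReal ω) t := by
  induction m generalizing t with
  | zero =>
    rw [Nat.zero_add, Nat.cast_one, logMean_one]
    rfl
  | succ m ih =>
    rcases eq_or_ne t 0 with rfl | ht
    -- At t = 0 both sides vanish, since the inverse of 0 is 0.
    · simp [repeatedAverage, runningAverage, logMean]
    have ht' : (0 : ℝ) < t := NNReal.coe_pos.2 (pos_iff_ne_zero.2 ht)
    rw [Nat.cast_succ (m + 1), ← logMean_succ (p := ((m + 1 : ℕ) : ℝ)) (by simp) ht'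
      (f := fun s => X s.toNNReal ω)
      (fun _ _ h => hmono (Real.toNNReal_mono h)) fun r => h0 _]
    rw [repeatedAverage, runningAverage]
    congr 1
    rw [intervalIntegral_eq_Ioo ht'.le, intervalIntegral_eq_Ioo ht'.le]
    refine setIntegral_congr_fun measurableSet_Ioo fun s hs => ?_
    rw [ih, Real.coe_toNNReal s hs.1.le]

lemma iteratedIntegral_succ (hmono : Monotone fun t => X t ω) (h0 : ∀ t, 0 ≤ X t ω) (m : ℕ)
    (t : ℝ≥0) :
    iteratedIntegral X (m + 1) t ω =
      fracIntegral ((m + 1 : ℕ) : ℝ) (fun s => X s.toNNReal ω) t := by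
  induction m generalizing t with
  | zero =>
    rw [Nat.zero_add, Nat.cast_one, fracIntegral_one]
    rfl
  | succ m ih =>
    rcases eq_or_ne t 0 with rfl | ht
    · simp [iteratedIntegral, fracIntegral]
    have ht' : (0 : ℝ) < t := NNReal.coe_pos.2 (pos_iff_ne_zero.2 ht)
    rw [Nat.cast_succ (m + 1), ← fracIntegral_succ (p := ((m + 1 : ℕ) : ℝ)) (by simp) ht'
      (f := fun s => X s.toNNReal ω)
      (fun _ _ h => hmono (Real.toNNReal_mono h)) fun r => h0 _]
    change ∫ s in (0 : ℝ)..t, iteratedIntegral X (m + 1) s.toNNReal ω = _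
    rw [intervalIntegral_eq_Ioo ht'.le, intervalIntegral_eq_Ioo ht'.le]
    refine setIntegral_congr_fun measurableSet_Ioo fun s hs => ?_
    rw [ih, Real.coe_toNNReal s hs.1.le]

lemma fractionalAverage_one (n : ℝ) :
    fractionalAverage X n 1 ω = pathIntegral X (logWeight n) ω := by
  rw [fractionalAverage, NNReal.coe_one, intervalIntegral_eq_Ioo zero_le_one, one_mul,
    pathIntegral, ← integral_const_mul]
  congr 1
  funext s
  rw [logWeight, one_div, Real.log_inv]
  ring

lemma fractionalQuasiAverage_one (n : ℝ) : fractionalQuasiAverage X n 1 ω =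
    pathIntegral X (fun s => (Real.Gamma n)⁻¹ * (1 - s) ^ (n - 1)) ω := by
  rw [fractionalQuasiAverage, NNReal.coe_one, intervalIntegral_eq_Ioo zero_le_one, Real.one_rpow,
    one_mul, pathIntegral, ← integral_const_mul]
  congr 1
  funext s
  ring

lemma repeatedAverage_one (hmono : Monotone fun t => X t ω) (h0 : ∀ t, 0 ≤ X t ω) {m : ℕ}
    (hm : 0 < m) : repeatedAverage X m 1 ω = fractionalAverage X m 1 ω := by
  obtain ⟨k, rfl⟩ := Nat.exists_eq_succ_of_ne_zero hm.ne'
  exact repeatedAverage_succ hmono h0 k 1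

lemma quasiAverage_one (hmono : Monotone fun t => X t ω) (h0 : ∀ t, 0 ≤ X t ω) {m : ℕ}
    (hm : 0 < m) : quasiAverage X m 1 ω = fractionalQuasiAverage X m 1 ω := by
  obtain ⟨k, rfl⟩ := Nat.exists_eq_succ_of_ne_zero hm.ne'
  rw [quasiAverage, iteratedIntegral_succ hmono h0, fractionalQuasiAverage, fracIntegral]
  simp

lemma runningAverage_one : runningAverage X 1 ω = pathIntegral X (fun _ => 1) ω := by
  rw [runningAverage, NNReal.coe_one, intervalIntegral_eq_Ioo zero_le_one, pathIntegral]
  simp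

end Paths

/-! ### Lévy measures of the regulated clocks -/

lemma integrableOn_logWeight {n : ℝ} (hn : 0 < n) : IntegrableOn (logWeight n) (Ioo 0 1) :=
  (integrableOn_neg_log_rpow hn).1.const_mul _

/-- The substitution r = exp(-x) maps (0, -log s) onto (s, 1) and gives a lower incomplete gamma
integral. This is where the mixing factor of type I comes from. -/
lemma tailIntegral_logWeight {n s : ℝ} (hn : 0 < n) (hs : s ∈ Ioo (0 : ℝ) 1) :
    tailIntegral (logWeight n) s = lowerGammaLog n s := by
  have hL := neg_log_pos hs
  have himg : (fun x : ℝ => Real.exp (-x)) '' Ioo 0 (-Real.log s) = Ioo s 1 := by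
    ext r
    constructor
    · rintro ⟨x, hx, rfl⟩
      refine ⟨?_, by rw [Real.exp_lt_one_iff]; linarith [hx.1]⟩
      rw [← Real.log_lt_iff_lt_exp hs.1]
      linarith [hx.2]
    · rintro ⟨h0, h1⟩
      have hr := hs.1.trans h0
      exact ⟨-Real.log r, ⟨by simpa using Real.log_neg hr h1,
        neg_lt_neg (Real.log_lt_log hs.1 h0)⟩, by simp [Real.exp_log hr]⟩
  have hcv := integral_image_eq_integral_abs_deriv_smul (s := Ioo 0 (-Real.log s))
    (f := fun x : ℝ => Real.exp (-x)) (f' := fun x => -Real.exp (-x)) measurableSet_Ioo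
    (fun x _ => by simpa using ((hasDerivAt_neg x).exp).hasDerivWithinAt)
    (fun x _ y _ hxy => by simpa using hxy) (fun r => (-Real.log r) ^ (n - 1))
  have heq : ∀ x : ℝ, |-Real.exp (-x)| • (-Real.log (Real.exp (-x))) ^ (n - 1) =
      x ^ (n - 1) * Real.exp (-x) := fun x => by
    rw [abs_neg, abs_of_pos (Real.exp_pos _), Real.log_exp, neg_neg, smul_eq_mul, mul_comm]
  simp_rw [heq] at hcv
  have hG := Real.Gamma_pos_of_pos hn
  rw [himg, ← intervalIntegral_eq_Ioo hL.le] at hcv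
  unfold logWeight
  rw [tailIntegral_eq hs.1.le, integral_const_mul, hcv, lowerGammaLog, upperGamma_eq_sub hn hL.le]
  field_simp
  ring

lemma tailIntegral_one {s : ℝ} (hs : s ∈ Ioo (0 : ℝ) 1) : tailIntegral (fun _ => 1) s = 1 - s := by
  rw [tailIntegral_eq hs.1.le]
  simp [hs.2.le]

lemma integral_one_sub_rpow {n s : ℝ} (hn : 0 < n) (hs : s ∈ Icc (0 : ℝ) 1) :
    IntegrableOn (fun r => (1 - r) ^ (n - 1)) (Ioo s 1) ∧
      ∫ r in Ioo s 1, (1 - r) ^ (n - 1) = (1 - s) ^ n / n := by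
  have h1 : IntervalIntegrable (fun x : ℝ => x ^ (n - 1)) volume (1 - s) (1 - 1) :=
    intervalIntegral.intervalIntegrable_rpow' (by linarith)
  constructor
  · have h2 := h1.comp_sub_left 1
    simp only [sub_sub_cancel] at h2
    exact (intervalIntegrable_iff_integrableOn_Ioo_of_le hs.2).1 h2
  · rw [← integral_Ioc_eq_integral_Ioo, ← intervalIntegral.integral_of_le hs.2,
      intervalIntegral.integral_comp_sub_left (fun x => x ^ (n - 1)) 1, integral_rpow (Or.inl
        (by linarith)), sub_self, sub_add_cancel, Real.zero_rpow hn.ne', sub_zero]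

lemma tailIntegral_rpow {n s : ℝ} (hn : 0 < n) (hs : s ∈ Ioo (0 : ℝ) 1) :
    tailIntegral (fun r => (Real.Gamma n)⁻¹ * (1 - r) ^ (n - 1)) s =
      (1 - s) ^ n / Real.Gamma (n + 1) := by
  rw [tailIntegral_eq hs.1.le, integral_const_mul, (integral_one_sub_rpow hn ⟨hs.1.le, hs.2.le⟩).2,
    Real.Gamma_add_one hn.ne']
  have := Real.Gamma_pos_of_pos hn
  field_simp

/-! ### From exponents to Lévy measures of averages and clocks -/

section Clocks

variable {Ω : Type u} [MeasurableSpace Ω] {P : Measure Ω} {X : ℝ≥0 → Ω → ℝ} {ν : Measure ℝ}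
  {n : ℝ}

lemma laplaceExponent_eq_realExponent
    (hν : IsLevyMeasureOf (laplaceTransform P (X 1)) ν) {u : ℝ} (hu : 0 ≤ u) :
    laplaceExponent P X u = realExponent ν u := by
  have h := hν.2 u (by simpa using hu)
  rw [laplaceTransform_ofReal, levyExponent_ofReal_eq_neg, ← Complex.ofReal_exp,
    Complex.ofReal_inj] at h
  rw [laplaceExponent, h, Real.log_exp, neg_neg]

lemma laplaceTransform_congr {A B : Ω → ℝ} (h : ∀ᵐ ω ∂P, A ω = B ω) :
    laplaceTransform P A = laplaceTransform P B := by
  funext u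
  refine integral_congr_ae ?_
  filter_upwards [h] with ω hω
  rw [hω]

lemma IsInducedBy.laplaceTransform_eq {Ω' : Type*} [MeasurableSpace Ω'] {P' : Measure Ω'}
    {W : ℝ≥0 → Ω' → ℝ} {A : ℝ≥0 → Ω → ℝ} (h : IsInducedBy P' W P A) (t : ℝ≥0) :
    laplaceTransform P' (W t) = laplaceTransform P (A t) := by
  funext u
  rw [laplaceTransform, laplaceTransform, complexMGF_congr_identDistrib (h.2 t)]

lemma IsSubordinator.isLevyMeasureOf_pathIntegral (hX : IsSubordinator P X) {g : ℝ → ℝ}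
    (hg : IntegrableOn g (Ioo 0 1)) (hg0 : ∀ s ∈ Ioo (0 : ℝ) 1, 0 ≤ g s) {μ : Measure ℝ}
    (hμ : IsLevyMeasure μ) (h : ∀ u : ℝ, 0 < u →
      ∫ s in Ioo (0 : ℝ) 1, laplaceExponent P X (u * tailIntegral g s) = realExponent μ u) :
    IsLevyMeasureOf (laplaceTransform P (pathIntegral X g)) μ := by
  have := hX.isProbabilityMeasure
  refine isLevyMeasureOf_laplaceTransform (hX.aemeasurable_pathIntegral hg)
    (hX.pathIntegral_nonneg hg0) hμ fun u hu => ?_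
  rw [hX.mgf_pathIntegral hg hg0 hu.le, intervalIntegral_eq_Ioo zero_le_one, h u hu]

lemma isLevyMeasureOf_fractionalAverage (hX : IsSubordinator P X)
    (hν : IsLevyMeasureOf (laplaceTransform P (X 1)) ν) (hn : 0 < n) :
    IsLevyMeasureOf (laplaceTransform P (fractionalAverage X n 1)) (typeILevyMeasure n ν) := by
  have : fractionalAverage X n 1 = pathIntegral X (logWeight n) :=
    funext fun ω => fractionalAverage_one n
  rw [this]
  refine hX.isLevyMeasureOf_pathIntegral (integrableOn_logWeight hn)
    (fun s hs => logWeight_nonneg hn hs) (isLevyMeasure_typeI hn hν.1) fun u hu => ?_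
  rw [realExponent_typeI hn hν.1 hu.le]
  refine setIntegral_congr_fun measurableSet_Ioo fun s hs => ?_
  rw [tailIntegral_logWeight hn hs, mul_comm u, laplaceExponent_eq_realExponent hν
    (mul_nonneg (lowerGammaLog_pos hn hs).le hu.le)]

lemma isLevyMeasureOf_fractionalQuasiAverage (hX : IsSubordinator P X)
    (hν : IsLevyMeasureOf (laplaceTransform P (X 1)) ν) (hn : 0 < n) :
    IsLevyMeasureOf (laplaceTransform P (fractionalQuasiAverage X n 1))
      (typeIIILevyMeasure n ν) := by
  have : fractionalQuasiAverage X n 1 =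
      pathIntegral X (fun s => (Real.Gamma n)⁻¹ * (1 - s) ^ (n - 1)) :=
    funext fun ω => fractionalQuasiAverage_one n
  rw [this]
  refine hX.isLevyMeasureOf_pathIntegral
    ((integral_one_sub_rpow hn ⟨le_rfl, zero_le_one⟩).1.const_mul _) (fun s hs => ?_)
    (isLevyMeasure_typeIII hn hν.1) fun u hu => ?_
  · have h1 := Real.rpow_nonneg (sub_nonneg.2 hs.2.le) (n - 1)
    have h2 := Real.Gamma_pos_of_pos hn
    positivity
  · rw [realExponent_typeIII hn hν.1 hu.le]
    -- The tail of the weight is (1-s)^n / Γ(n+1), while the mixture uses s^n / Γ(n+1); reflecting s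
    -- ↦ 1 - s matches them.
    have h := intervalIntegral.integral_comp_sub_left (a := 0) (b := 1)
      (fun s => realExponent ν (s ^ n / Real.Gamma (n + 1) * u)) 1
    rw [sub_self, sub_zero, intervalIntegral_eq_Ioo zero_le_one,
      intervalIntegral_eq_Ioo zero_le_one] at h
    rw [← h]
    refine setIntegral_congr_fun measurableSet_Ioo fun s hs => ?_
    have hs' : 1 - s ∈ Ioo (0 : ℝ) 1 := ⟨by linarith [hs.2], by linarith [hs.1]⟩
    rw [tailIntegral_rpow hn hs, mul_comm u, laplaceExponent_eq_realExponent hν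
      (mul_nonneg (rpow_div_Gamma_pos hn hs').le hu.le)]

lemma laplaceTransform_repeatedAverage (hX : IsSubordinator P X) {m : ℕ} (hm : 0 < m) :
    laplaceTransform P (repeatedAverage X m 1) = laplaceTransform P (fractionalAverage X m 1) := by
  refine laplaceTransform_congr ?_
  filter_upwards [hX.paths, hX.ae_nonneg] with ω hp h0 using repeatedAverage_one hp.1 h0 hm

lemma laplaceTransform_quasiAverage (hX : IsSubordinator P X) {m : ℕ} (hm : 0 < m) :
    laplaceTransform P (quasiAverage X m 1) =
      laplaceTransform P (fractionalQuasiAverage X m 1) := by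
  refine laplaceTransform_congr ?_
  filter_upwards [hX.paths, hX.ae_nonneg] with ω hp h0 using quasiAverage_one hp.1 h0 hm

/-! #### Type II -/

lemma IsSubordinator.laplaceExponent_zero (hX : IsSubordinator P X) : laplaceExponent P X 0 = 0 := by
  have := hX.isProbabilityMeasure
  simp [laplaceExponent]

/-- The exponent is extended by its value 0 to negative arguments, because `logMean_succ` asks for a
monotone nonnegative function on all of ℝ. -/
lemma IsSubordinator.monotone_laplaceExponent_max (hX : IsSubordinator P X) :
    Monotone fun r => laplaceExponent P X (max r 0) := fun r s h =>
  hX.monotoneOn_laplaceExponent (mem_Ici.2 (le_max_right r 0)) (mem_Ici.2 (le_max_right s 0))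
    (max_le_max_right 0 h)

lemma IsSubordinator.laplaceExponent_max_nonneg (hX : IsSubordinator P X) (r : ℝ) :
    0 ≤ laplaceExponent P X (max r 0) := by
  have h : (0 : ℝ) ≤ max r 0 := le_max_right _ _
  exact hX.laplaceExponent_zero.ge.trans
    (hX.monotoneOn_laplaceExponent self_mem_Ici (mem_Ici.2 h) h)

/-- The exponent of the running average of a subordinator is the mean of its exponent. -/
lemma IsSubordinator.laplaceExponent_average (hX : IsSubordinator P X) {u : ℝ} (hu : 0 < u) :
    mgf (runningAverage X 1) P (-u) =
      Real.exp (-(u⁻¹ * ∫ r in (0 : ℝ)..u, laplaceExponent P X r)) := by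
  have : runningAverage X 1 = pathIntegral X (fun _ => 1) := funext fun ω => runningAverage_one
  rw [this, hX.mgf_pathIntegral (integrableOn_const (by simp)) (fun _ _ => zero_le_one) hu.le]
  congr 2
  have h1 := intervalIntegral.integral_comp_sub_left (a := 0) (b := 1)
    (fun s => laplaceExponent P X (u * s)) 1
  have h2 := intervalIntegral.integral_comp_mul_left (a := 0) (b := 1)
    (laplaceExponent P X) hu.ne'
  rw [sub_self, sub_zero] at h1
  rw [mul_zero, mul_one, smul_eq_mul] at h2
  rw [← h2, ← h1, intervalIntegral_eq_Ioo zero_le_one, intervalIntegral_eq_Ioo zero_le_one]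
  refine setIntegral_congr_fun measurableSet_Ioo fun s hs => ?_
  rw [tailIntegral_one hs]

/-- A type-II clock of positive degree has the mean of that degree of the original exponent. -/
lemma isTypeIIClock_exponent (hX : IsSubordinator P X) {m : ℕ} {Ω' : Type u}
    [MeasurableSpace Ω'] {P' : Measure Ω'} {W : ℝ≥0 → Ω' → ℝ}
    (h : IsTypeIIClock P X m Ω' P' W) : IsSubordinator P' W ∧
      ∀ u, 0 < u → u⁻¹ * ∫ r in (0 : ℝ)..u, laplaceExponent P' W r =
        logMean ((m + 1 : ℕ) : ℝ) (fun r => laplaceExponent P X (max r 0)) u := by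
  -- The invariant concerns the mean of the exponent, not the exponent itself: degree 0 then
  -- corresponds to `logMean 1`, whereas `logMean 0` would involve the degenerate value of Γ at 0.
  induction h with
  | zero =>
    refine ⟨hX, fun u hu => ?_⟩
    rw [Nat.zero_add, Nat.cast_one, logMean_one, intervalIntegral_eq_Ioo hu.le,
      intervalIntegral_eq_Ioo hu.le]
    congr 1
    refine setIntegral_congr_fun measurableSet_Ioo fun s hs => ?_
    rw [max_eq_left hs.1.le]
  | succ m Ω₁ Ω₂ P₁ P₂ Y W _ hind ih =>
    refine ⟨hind.1, fun u hu => ?_⟩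
    rw [Nat.cast_succ (m + 1), ← logMean_succ (by simp) hu hX.monotone_laplaceExponent_max
      hX.laplaceExponent_max_nonneg, intervalIntegral_eq_Ioo hu.le, intervalIntegral_eq_Ioo hu.le]
    congr 1
    refine setIntegral_congr_fun measurableSet_Ioo fun s hs => ?_
    -- The law of W at time 1 is that of the average of Y, so the exponent of W at s is the mean
    -- over (0, s) of the exponent of Y.
    rw [← ih.2 s hs.1, laplaceExponent, ← mgf_id_map (hind.2 1).aemeasurable_fst,
      (hind.2 1).map_eq, mgf_id_map (hind.2 1).aemeasurable_snd,
      ih.1.laplaceExponent_average hs.1, Real.log_exp, neg_neg]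

lemma isLevyMeasureOf_runningAverage_typeII (hX : IsSubordinator P X)
    (hν : IsLevyMeasureOf (laplaceTransform P (X 1)) ν) {m : ℕ} {Ω' : Type u}
    [MeasurableSpace Ω'] {P' : Measure Ω'} {Y : ℝ≥0 → Ω' → ℝ}
    (h : IsTypeIIClock P X m Ω' P' Y) :
    IsLevyMeasureOf (laplaceTransform P' (runningAverage Y 1))
      (typeIILevyMeasure ((m + 1 : ℕ) : ℝ) ν) := by
  have hn : (0 : ℝ) < ((m + 1 : ℕ) : ℝ) := by positivity
  obtain ⟨hY, hexp⟩ := isTypeIIClock_exponent hX h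
  have := hY.isProbabilityMeasure
  have hA : runningAverage Y 1 = pathIntegral Y (fun _ => 1) := funext fun ω => runningAverage_one
  have hi : IntegrableOn (fun _ : ℝ => (1 : ℝ)) (Ioo 0 1) := integrableOn_const (by simp)
  refine isLevyMeasureOf_laplaceTransform (hA ▸ hY.aemeasurable_pathIntegral hi)
    (hA ▸ hY.pathIntegral_nonneg fun _ _ => zero_le_one) (isLevyMeasure_typeII hn hν.1)
    fun u hu => ?_
  rw [hY.laplaceExponent_average hu, hexp u hu, logMean_eq_integral_logWeight hu,
    realExponent_typeII hn hν.1 hu.le]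
  congr 2
  refine setIntegral_congr_fun measurableSet_Ioo fun s hs => ?_
  have hsu : 0 ≤ s * u := mul_nonneg hs.1.le hu.le
  rw [max_eq_left hsu, laplaceExponent_eq_realExponent hν hsu]

lemma isLevyMeasureOf_typeIIClock (hX : IsSubordinator P X)
    (hν : IsLevyMeasureOf (laplaceTransform P (X 1)) ν) {m : ℕ} (hm : 0 < m) {Ω' : Type u}
    [MeasurableSpace Ω'] {P' : Measure Ω'} {W : ℝ≥0 → Ω' → ℝ}
    (h : IsTypeIIClock P X m Ω' P' W) :
    IsLevyMeasureOf (laplaceTransform P' (W 1)) (typeIILevyMeasure m ν) := by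
  cases h with
  | zero => exact absurd hm (lt_irrefl 0)
  | succ m Ω₁ Ω₂ P₁ P₂ Y W hY hind =>
    rw [hind.laplaceTransform_eq 1]
    exact isLevyMeasureOf_runningAverage_typeII hX hν hY

end Clocks

end ClockRegulation

end

theorem theorem2 {Ω : Type u} [MeasurableSpace Ω] (P : Measure Ω) (X : ℝ≥0 → Ω → ℝ)
    (hX : IsSubordinator P X) (ν : Measure ℝ)
    (hν : IsLevyMeasureOf (laplaceTransform P (X 1)) ν) (n : ℝ) (hn : 0 < n) :
    -- type I: Laplace transform of real degree, fractional average, repeated average, clocks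
    ((∀ μ, IsLevyMeasureOf (typeILaplace n ν) μ ↔ μ = typeILevyMeasure n ν) ∧
      (∀ μ, IsLevyMeasureOf (laplaceTransform P (fractionalAverage X n 1)) μ ↔
        μ = typeILevyMeasure n ν) ∧
      (∀ m : ℕ, (m : ℝ) = n →
        (∀ μ, IsLevyMeasureOf (laplaceTransform P (repeatedAverage X m 1)) μ ↔
          μ = typeILevyMeasure n ν) ∧
        (∀ (Ω' : Type u) [MeasurableSpace Ω'] (P' : Measure Ω') (W : ℝ≥0 → Ω' → ℝ),
          IsInducedBy P' W P (repeatedAverage X m) →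
          ∀ μ, IsLevyMeasureOf (laplaceTransform P' (W 1)) μ ↔ μ = typeILevyMeasure n ν))) ∧
    -- type II: Laplace transform of real degree, average of the clock of degree `m - 1`, clocks
    ((∀ μ, IsLevyMeasureOf (typeIILaplace n ν) μ ↔ μ = typeIILevyMeasure n ν) ∧
      (∀ m : ℕ, (m : ℝ) = n →
        (∀ (Ω' : Type u) [MeasurableSpace Ω'] (P' : Measure Ω') (Y : ℝ≥0 → Ω' → ℝ),
          IsTypeIIClock P X (m - 1) Ω' P' Y →
          ∀ μ, IsLevyMeasureOf (laplaceTransform P' (runningAverage Y 1)) μ ↔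
            μ = typeIILevyMeasure n ν) ∧
        (∀ (Ω' : Type u) [MeasurableSpace Ω'] (P' : Measure Ω') (W : ℝ≥0 → Ω' → ℝ),
          IsTypeIIClock P X m Ω' P' W →
          ∀ μ, IsLevyMeasureOf (laplaceTransform P' (W 1)) μ ↔ μ = typeIILevyMeasure n ν))) ∧
    -- type III: Laplace transform of real degree, fractional and iterated quasi-average, clocks
    ((∀ μ, IsLevyMeasureOf (typeIIILaplace n ν) μ ↔ μ = typeIIILevyMeasure n ν) ∧
      (∀ μ, IsLevyMeasureOf (laplaceTransform P (fractionalQuasiAverage X n 1)) μ ↔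
        μ = typeIIILevyMeasure n ν) ∧
      (∀ m : ℕ, (m : ℝ) = n →
        (∀ μ, IsLevyMeasureOf (laplaceTransform P (quasiAverage X m 1)) μ ↔
          μ = typeIIILevyMeasure n ν) ∧
        (∀ (Ω' : Type u) [MeasurableSpace Ω'] (P' : Measure Ω') (W : ℝ≥0 → Ω' → ℝ),
          IsInducedBy P' W P (quasiAverage X m) →
          ∀ μ, IsLevyMeasureOf (laplaceTransform P' (W 1)) μ ↔
            μ = typeIIILevyMeasure n ν))) ∧
    -- Lévy densities
    (∀ ℓ : ℝ → ℝ, Measurable ℓ → (∀ z, 0 < z → 0 ≤ ℓ z) → HasLevyDensity ν ℓ →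
      ((∀ᵐ z ∂(volume.restrict (Ioi (0 : ℝ))),
          IntegrableOn (fun y => ℓ (y * z) / (y * invUpperGamma n (1 - 1 / y) ^ (n - 1)))
            (Ioi 1)) ∧
        HasLevyDensity (typeILevyMeasure n ν) (fun z => Real.Gamma n *
          ∫ y in Ioi 1, ℓ (y * z) / (y * invUpperGamma n (1 - 1 / y) ^ (n - 1)))) ∧
      ((∀ᵐ z ∂(volume.restrict (Ioi (0 : ℝ))),
          IntegrableOn (fun y => Real.log y ^ (n - 1) * ℓ (y * z) / y) (Ioi 1)) ∧
        HasLevyDensity (typeIILevyMeasure n ν) (fun z => 1 / Real.Gamma n *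
          ∫ y in Ioi 1, Real.log y ^ (n - 1) * ℓ (y * z) / y)) ∧
      ((∀ᵐ z ∂(volume.restrict (Ioi (0 : ℝ))),
          IntegrableOn (fun y => (Real.Gamma (n + 1) / y) ^ (1 / n) * (ℓ (y * z) / n))
            (Ioi (Real.Gamma (n + 1)))) ∧
        HasLevyDensity (typeIIILevyMeasure n ν) (fun z =>
          ∫ y in Ioi (Real.Gamma (n + 1)),
            (Real.Gamma (n + 1) / y) ^ (1 / n) * (ℓ (y * z) / n)))) := by
  refine ⟨⟨(isLevyMeasureOf_typeILaplace hn hν.1).iff_eq,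
      (isLevyMeasureOf_fractionalAverage hX hν hn).iff_eq, fun m hm => ?_⟩,
    ⟨(isLevyMeasureOf_typeIILaplace hn hν.1).iff_eq, fun m hm => ?_⟩,
    ⟨(isLevyMeasureOf_typeIIILaplace hn hν.1).iff_eq,
      (isLevyMeasureOf_fractionalQuasiAverage hX hν hn).iff_eq, fun m hm => ?_⟩,
    fun ℓ hℓ hℓ0 hd => ⟨hasLevyDensity_typeI hn hν.1 hℓ hℓ0 hd,
      hasLevyDensity_typeII hn hν.1 hℓ hℓ0 hd, hasLevyDensity_typeIII hn hν.1 hℓ hℓ0 hd⟩⟩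
  · subst hm
    have hm0 : 0 < m := Nat.cast_pos.1 hn
    have h := isLevyMeasureOf_fractionalAverage hX hν hn
    rw [← laplaceTransform_repeatedAverage hX hm0] at h
    -- Only the marginal law at time 1 of the induced clock enters.
    exact ⟨h.iff_eq, fun Ω' _ P' W hW => by rw [hW.laplaceTransform_eq 1]; exact h.iff_eq⟩
  · subst hm
    have hm0 : 0 < m := Nat.cast_pos.1 hn
    refine ⟨fun Ω' _ P' Y hY => ?_,
      fun Ω' _ P' W hW => (isLevyMeasureOf_typeIIClock hX hν hm0 hW).iff_eq⟩
    have h := isLevyMeasureOf_runningAverage_typeII hX hν hY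
    -- The truncated subtraction m - 1 is exact because m = n > 0.
    rw [Nat.sub_add_cancel hm0] at h
    exact h.iff_eq
  · subst hm
    have hm0 : 0 < m := Nat.cast_pos.1 hn
    have h := isLevyMeasureOf_fractionalQuasiAverage hX hν hn
    rw [← laplaceTransform_quasiAverage hX hm0] at h
    exact ⟨h.iff_eq, fun Ω' _ P' W hW => by rw [hW.laplaceTransform_eq 1]; exact h.iff_eq⟩
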